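/- **Theorem (Approximate Wasserstein bound).** Let $\mathscr X\subseteq\mathbb R^n$ be convex with nonempty interior. Let $\widehat\Phi_{\tau_0,\tau_1}:\mathscr X\to\mathscr X$, $0\le\tau_0\le\tau_1\le1$, be the learned two-time map, with $\widehat\Phi_{\tau,\tau}=\mathrm{Id}$ and induced velocity field $\hat b$, i.e. $\partial_{\tau_1}\widehat\Phi_{\tau_0,\tau_1}(x)=\hat b_{\tau_1}(\widehat\Phi_{\tau_0,\tau_1}(x))$. Assume that $\tau\mapsto\widehat\Phi_{0,\tau}(x)$ is $C^1$ for each $x\in\mathscr X$, and that $\hat b_\tau$ is differentiable in $x$ with Jacobian $D\hat b_\tau(x)$ continuous on $\mathscr X\times[0,1]$. Let $M(x,\tau)=\Theta(x,\tau)^\top\Theta(x,\tau)\in\mathbb R^{n\times n}$ be differentiable on $\mathscr X\times[0,1]$ with $\underline m I\preceq M(x,\tau)\preceq\overline m I$ for all $(x,\tau)\in\mathscr X\times[0,1]$, where $\underline m>0$. Let $\alpha\in\mathbb R$, let $\dot M=\partial_\tau M+\sum_k \hat b_k\,\partial_{x_k}M$ be the derivative of $M$ along $\hat b$, and assume that the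 contraction residual $$\mathcal R:=\dot M+(D\hat b_\tau)^\top M+M\,D\hat b_\tau-2\alpha M$$ is continuous on $\mathscr X\times[0,1]$. With $[A]_+$ the projection of a symmetric matrix $A$ onto the cone of positive semidefinite matrices and $\|\cdot\|_F$ the Frobenius norm, assume $$\varepsilon_{\mathrm{ctr}}:=\sup_{(x,\tau)\in\mathscr X\times[0,1]}\bigl\|[\mathcal R(x,\tau)]_+\bigr\|_F<\infty,\qquad\text{and set}\qquad \tilde\alpha:=\alpha+\frac{\varepsilon_{\mathrm{ctr}}}{2\underline m}.$$ Let $b_\tau=\hat b_\tau+d_\tau$ be the true velocity field on $\mathscr X$, with $\overline d:=\sup_{\mathscr X\times[0,1]}\|d_\tau(x)\|<\infty$, and let $\Phi_{\tau_0,\tau_1}:\mathscr X\to\mathscr X$ be a two-time flow map of $b$ (that is, $\Phi_{\tau,\tau}=\mathrm{Id}$ and $\partial_{\tau_1}\Phi_{\tau_0,\tau_1}(x)=b_{\tau_1}(\Phi_{\tau_0,\tau_1}(x))$) such that each $\Phi_{0,\tau}$ is Borel measurable. Put $$\kappa:=\sqrt{\overline m/\underline m},\qquad \tilde\delta_\tau:=\kappa\,\overline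 d\int_0^\tau e^{\tilde\alpha(\tau-r)}\,dr .$$ Then: 1. For all $(x,\tau)\in\mathscr X\times[0,1]$, with $\operatorname{sym}(A)=\tfrac12(A+A^\top)$, $$\dot M+2\operatorname{sym}(M\,D\hat b_\tau)\preceq2\tilde\alpha M .$$ 2. For all Borel probability measures $\mu_0,\nu_0$ on $\mathscr X$ with finite second moments and all $\tau\in[0,1]$, the measures $(\widehat\Phi_{0,\tau})_\#\mu_0$ and $(\Phi_{0,\tau})_\#\nu_0$ are again probability measures with finite second moments, and $$W_2\bigl((\widehat\Phi_{0,\tau})_\#\mu_0,(\Phi_{0,\tau})_\#\nu_0\bigr)\le\kappa\,e^{\tilde\alpha\tau}\,W_2(\mu_0,\nu_0)+\tilde\delta_\tau .$$ 3. For all probability densities $\rho,\eta$ on $\mathscr X$ with finite second moments, the learned and true Perron–Frobenius operators $\widehat{\mathscr P}\rho:=(\widehat\Phi_{0,1})_\#\rho$ and $\mathscr P\eta:=(\Phi_{0,1})_\#\eta$ satisfy $$W_2(\widehat{\mathscr P}\rho,\mathscr P\eta)\le\kappa\,e^{\tilde\alpha}\,W_2(\rho,\eta)+\tilde\delta_1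 .$$ 4. In particular, for the same input density, $W_2(\widehat{\mathscr P}\rho,\mathscr P\rho)\le\delta$ with the terminal bias $\delta:=\tilde\delta_1=\kappa\,\overline d\int_0^1e^{\tilde\alpha(1-r)}\,dr$. Here $W_2$ is the 2-Wasserstein distance for the Euclidean norm, and a density is identified with the measure it defines. -/

import Mathlib

open MeasureTheory Set
open scoped ENNReal Matrix

namespace FlowContraction

variable {n : ℕ}

noncomputable section

/-! ### Matrices -/

/-- The Frobenius norm `‖A‖_F` of a square real matrix. -/
def frobNorm (A : Matrix (Fin n) (Fin n) ℝ) : ℝ :=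
  √(∑ i, ∑ j, A i j ^ 2)

/-- The symmetric part `sym A = (A + Aᵀ) / 2`. -/
def symPart (A : Matrix (Fin n) (Fin n) ℝ) : Matrix (Fin n) (Fin n) ℝ :=
  (1 / 2 : ℝ) • (A + Aᵀ)

/-- `P` is a point of the cone of symmetric positive semidefinite matrices that is nearest to
`A` in the Frobenius norm. -/
def IsNearestPSD (A P : Matrix (Fin n) (Fin n) ℝ) : Prop :=
  P.PosSemidef ∧
    ∀ Q : Matrix (Fin n) (Fin n) ℝ, Q.PosSemidef → frobNorm (A - P) ≤ frobNorm (A - Q)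

theorem exists_isNearestPSD (A : Matrix (Fin n) (Fin n) ℝ) : ∃ P, IsNearestPSD A P := by
  let mat : EuclideanSpace ℝ (Fin n × Fin n) → Matrix (Fin n) (Fin n) ℝ :=
    fun v => Matrix.of fun i j => v (i, j)
  let vec : Matrix (Fin n) (Fin n) ℝ → EuclideanSpace ℝ (Fin n × Fin n) :=
    fun B => WithLp.toLp 2 fun p => B p.1 p.2
  have hmv : ∀ B, mat (vec B) = B := fun B => by ext i j; simp [mat, vec]
  have hdist : ∀ v, dist (vec A) v = frobNorm (A - mat v) := fun v => by
    rw [EuclideanSpace.dist_eq, frobNorm, Fintype.sum_prod_type]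
    simp [mat, vec, Real.dist_eq, sq_abs]
  have hcont : Continuous mat := by
    refine continuous_matrix fun i j => ?_
    simp only [mat, Matrix.of_apply]
    fun_prop
  have hclosed : IsClosed {v | (mat v).PosSemidef} := by
    simp only [Matrix.posSemidef_iff_dotProduct_mulVec, Matrix.IsHermitian, ofPred_and,
      ofPred_forall]
    refine IsClosed.inter (isClosed_eq (hcont.matrix_conjTranspose) hcont)
      (isClosed_iInter fun x => isClosed_le continuous_const ?_)
    exact continuous_const.dotProduct (hcont.matrix_mulVec continuous_const)
  obtain ⟨v, hv, hmin⟩ := hclosed.exists_infDist_eq_dist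
    ⟨vec 0, by simpa [hmv] using Matrix.PosSemidef.zero⟩ (vec A)
  refine ⟨mat v, hv, fun Q hQ => ?_⟩
  rw [← hdist, ← hmin, ← hmv Q, ← hdist]
  exact Metric.infDist_le_dist_of_mem (by simpa [hmv] using hQ)

/-- The projection `[A]₊` of `A` onto the cone of symmetric positive semidefinite matrices (the
nearest point of the cone in the Frobenius norm). -/
def psdPart (A : Matrix (Fin n) (Fin n) ℝ) : Matrix (Fin n) (Fin n) ℝ :=
  Classical.choose (exists_isNearestPSD A)

theorem psdPart_spec (A : Matrix (Fin n) (Fin n) ℝ) : IsNearestPSD A (psdPart A) :=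
  Classical.choose_spec (exists_isNearestPSD A)

/-! ### Velocity fields, flows, and the contraction residual

Velocity fields are written `b τ x`, with `τ` the auxiliary time in `[0, 1]`; only their values at
points `x` of the state space `X` matter. -/

/-- `Φ τ₀ τ₁ : X → X`, `0 ≤ τ₀ ≤ τ₁ ≤ 1`, is a two-time flow map generated by `b`:
`Φ τ τ = id` and `∂_{τ₁} Φ τ₀ τ₁ x = b τ₁ (Φ τ₀ τ₁ x)`. -/
structure IsTwoTimeFlow (X : Set (EuclideanSpace ℝ (Fin n)))
    (b : ℝ → EuclideanSpace ℝ (Fin n) → EuclideanSpace ℝ (Fin n)) (Φ : ℝ → ℝ → X → X) : Prop where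
  self : ∀ τ ∈ Icc (0 : ℝ) 1, ∀ x : X, Φ τ τ x = x
  deriv : ∀ τ₀ ∈ Icc (0 : ℝ) 1, ∀ τ₁ ∈ Icc τ₀ 1, ∀ x : X,
    HasDerivWithinAt (fun r => (Φ τ₀ r x : EuclideanSpace ℝ (Fin n)))
      (b τ₁ (Φ τ₀ τ₁ x)) (Icc τ₀ 1) τ₁

/-- The Jacobian matrix `Db_τ(x)` of `b τ` on `X`, with entries `∂_j b_i`. -/
def jacobian (X : Set (EuclideanSpace ℝ (Fin n)))
    (b : ℝ → EuclideanSpace ℝ (Fin n) → EuclideanSpace ℝ (Fin n))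
    (x : EuclideanSpace ℝ (Fin n)) (τ : ℝ) : Matrix (Fin n) (Fin n) ℝ :=
  Matrix.of fun i j => fderivWithin ℝ (b τ) X x (EuclideanSpace.single j 1) i

/-- The metric `M(x, τ) = Θ(x, τ)ᵀ Θ(x, τ)`. -/
def metric (Θ : EuclideanSpace ℝ (Fin n) → ℝ → Matrix (Fin n) (Fin n) ℝ)
    (x : EuclideanSpace ℝ (Fin n)) (τ : ℝ) : Matrix (Fin n) (Fin n) ℝ :=
  (Θ x τ)ᵀ * Θ x τ

/-- The derivative `Ṁ = ∂_τ M + ∑ₖ bₖ ∂ₖ M` of the metric along the flow of `b`, that is, the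
derivative of `M` on `X × [0, 1]` in the direction `(b_τ(x), 1)`. -/
def metricDot (X : Set (EuclideanSpace ℝ (Fin n)))
    (b : ℝ → EuclideanSpace ℝ (Fin n) → EuclideanSpace ℝ (Fin n))
    (Θ : EuclideanSpace ℝ (Fin n) → ℝ → Matrix (Fin n) (Fin n) ℝ)
    (x : EuclideanSpace ℝ (Fin n)) (τ : ℝ) : Matrix (Fin n) (Fin n) ℝ :=
  Matrix.of fun i j =>
    fderivWithin ℝ (fun p : EuclideanSpace ℝ (Fin n) × ℝ => metric Θ p.1 p.2 i j)
      (X ×ˢ Icc (0 : ℝ) 1) (x, τ) (b τ x, 1)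

/-- The contraction residual `R = Ṁ + (Db)ᵀ M + M Db - 2 α M`. -/
def contractionResidual (X : Set (EuclideanSpace ℝ (Fin n)))
    (b : ℝ → EuclideanSpace ℝ (Fin n) → EuclideanSpace ℝ (Fin n))
    (Θ : EuclideanSpace ℝ (Fin n) → ℝ → Matrix (Fin n) (Fin n) ℝ) (α : ℝ)
    (x : EuclideanSpace ℝ (Fin n)) (τ : ℝ) : Matrix (Fin n) (Fin n) ℝ :=
  metricDot X b Θ x τ + (jacobian X b x τ)ᵀ * metric Θ x τ + metric Θ x τ * jacobian X b x τ
    - (2 * α) • metric Θ x τ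

/-- The set of values `‖[R(x, τ)]₊‖_F`, `(x, τ) ∈ X × [0, 1]`. -/
def residualNorms (X : Set (EuclideanSpace ℝ (Fin n)))
    (b : ℝ → EuclideanSpace ℝ (Fin n) → EuclideanSpace ℝ (Fin n))
    (Θ : EuclideanSpace ℝ (Fin n) → ℝ → Matrix (Fin n) (Fin n) ℝ) (α : ℝ) : Set ℝ :=
  (fun p : EuclideanSpace ℝ (Fin n) × ℝ =>
    frobNorm (psdPart (contractionResidual X b Θ α p.1 p.2))) '' (X ×ˢ Icc (0 : ℝ) 1)

/-- `ε_ctr`, the supremum of `‖[R(x, τ)]₊‖_F` over `X × [0, 1]`. -/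
def epsCtr (X : Set (EuclideanSpace ℝ (Fin n)))
    (b : ℝ → EuclideanSpace ℝ (Fin n) → EuclideanSpace ℝ (Fin n))
    (Θ : EuclideanSpace ℝ (Fin n) → ℝ → Matrix (Fin n) (Fin n) ℝ) (α : ℝ) : ℝ :=
  sSup (residualNorms X b Θ α)

/-- The inflated rate `α̃ = α + ε_ctr / (2 m)`. -/
def alphaTilde (X : Set (EuclideanSpace ℝ (Fin n)))
    (b : ℝ → EuclideanSpace ℝ (Fin n) → EuclideanSpace ℝ (Fin n))
    (Θ : EuclideanSpace ℝ (Fin n) → ℝ → Matrix (Fin n) (Fin n) ℝ) (α m : ℝ) : ℝ :=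
  α + epsCtr X b Θ α / (2 * m)

/-- The set of values `‖d_τ(x)‖`, `(x, τ) ∈ X × [0, 1]`. -/
def mismatchNorms (X : Set (EuclideanSpace ℝ (Fin n)))
    (d : ℝ → EuclideanSpace ℝ (Fin n) → EuclideanSpace ℝ (Fin n)) : Set ℝ :=
  (fun p : EuclideanSpace ℝ (Fin n) × ℝ => ‖d p.2 p.1‖) '' (X ×ˢ Icc (0 : ℝ) 1)

/-- The mismatch level `D`, the supremum of `‖d_τ(x)‖` over `X × [0, 1]`. -/
def mismatch (X : Set (EuclideanSpace ℝ (Fin n)))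
    (d : ℝ → EuclideanSpace ℝ (Fin n) → EuclideanSpace ℝ (Fin n)) : ℝ :=
  sSup (mismatchNorms X d)

/-- The condition number `κ = √(M / m)` of metric bounds `m ≤ M`. -/
def kappa (m M : ℝ) : ℝ := √(M / m)

/-- The bias `κ D ∫₀^τ exp (a (τ - r)) dr` for the rate `a` and the perturbation level `D`. -/
def bias (κ D a τ : ℝ) : ℝ := κ * D * ∫ r in (0 : ℝ)..τ, Real.exp (a * (τ - r))

/-! ### Measures on the state space -/

/-- `μ ∈ 𝒫₂(X)`: a Borel probability measure on `X` with finite second moment. -/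
def IsP2 {X : Set (EuclideanSpace ℝ (Fin n))} (μ : Measure X) : Prop :=
  IsProbabilityMeasure μ ∧
    ∫⁻ x, ENNReal.ofReal (‖(x : EuclideanSpace ℝ (Fin n))‖ ^ 2) ∂μ < ∞

/-- The couplings `Π(μ, ν)`: the measures on `X × X` with marginals `μ` and `ν`. -/
def couplings {X : Set (EuclideanSpace ℝ (Fin n))} (μ ν : Measure X) : Set (Measure (X × X)) :=
  {π | π.map Prod.fst = μ ∧ π.map Prod.snd = ν}

/-- The `2`-Wasserstein distance, with values in `[0, ∞]`. -/
def W2 {X : Set (EuclideanSpace ℝ (Fin n))} (μ ν : Measure X) : ℝ≥0∞ :=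
  (⨅ π ∈ couplings μ ν,
    ∫⁻ p, ENNReal.ofReal
      (‖(p.1 : EuclideanSpace ℝ (Fin n)) - (p.2 : EuclideanSpace ℝ (Fin n))‖ ^ 2) ∂π) ^ (1 / 2 : ℝ)

/-- Lebesgue measure `dx` on `X`. -/
def lebesgue (X : Set (EuclideanSpace ℝ (Fin n))) : Measure X :=
  Measure.comap Subtype.val (volume : Measure (EuclideanSpace ℝ (Fin n)))

/-- `ρ ∈ 𝒟(X)`: an admissible probability density on `X` (with respect to Lebesgue measure) with
finite second moment. -/
structure IsDensity {X : Set (EuclideanSpace ℝ (Fin n))} (ρ : X → ℝ) : Prop where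
  integrable : Integrable ρ (lebesgue X)
  nonneg : 0 ≤ᵐ[lebesgue X] ρ
  integral_eq_one : ∫ x, ρ x ∂(lebesgue X) = 1
  second_moment :
    Integrable (fun x : X => ‖(x : EuclideanSpace ℝ (Fin n))‖ ^ 2 * ρ x) (lebesgue X)

/-- The measure `ρ(x) dx` on `X`. -/
def densityMeasure {X : Set (EuclideanSpace ℝ (Fin n))} (ρ : X → ℝ) : Measure X :=
  (lebesgue X).withDensity fun x => ENNReal.ofReal (ρ x)

/-- The Perron--Frobenius operator of the map `T`: pushforward of measures along `T`. -/
def perronFrobenius {X : Set (EuclideanSpace ℝ (Fin n))} (T : X → X) (μ : Measure X) : Measure X :=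
  μ.map T

end

end FlowContraction

open FlowContraction

/-!
The residual `R` satisfies `R ⪯ [R]₊ ⪯ ε I ⪯ (ε / m) M`, where the first inequality is the
optimality condition for the projection (`IsNearestPSD.dotProduct_mulVec_le`). Hence the learned
field is contracting in the metric `M` at the inflated rate `α̃` (`posSemidef_alphaTilde`), which is
the first claim.

Everything else follows from the pointwise estimate
`‖Φhat 0 τ x - Φ 0 τ y‖ ≤ κ e^{α̃ τ} ‖x - y‖ + κ D ∫₀^τ e^{α̃ (τ - r)} dr`
(`IsContracting.norm_flow_sub_perturbed_le`), applied under a coupling with Minkowski's inequality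
(`W2_map_le`). Its proof never differentiates the flow in the initial point.

* For a trajectory `p` and a trajectory `q` starting close to it, the energy
  `(q - p)ᵀ M(p, t) (q - p)` has a derivative of at most `2 (α̃ + ε)` times itself as long as `q`
  stays so close to `p` that the linearization of the field along the compact trajectory `p` is
  accurate. The resulting Grönwall bound keeps `q` in that region
  (`IsContracting.exists_local_bound`). It also yields uniqueness of trajectories, thus the
  semigroup law of the learned flow.
* A local Lipschitz bound on a convex set is a global one, so `Φhat s t` is Lipschitz on `X` with
  constant `κ e^{α̃ (t - s)}` (`IsContracting.flow_norm_sub_le`); in particular it is Borel.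
* The curve `s ↦ Φhat s τ (Φ 0 s y)` leads from `Φhat 0 τ y` to `Φ 0 τ y`. By the semigroup law and
  the Lipschitz bound its speed is at most `κ e^{α̃ (τ - s)} D`, because over a short time the two
  flows started at the same point separate at speed at most about `D`
  (`IsContracting.exists_consistency`, `IsContracting.norm_perturbed_sub_le`).
-/

namespace FlowContraction

/-! ### Quadratic forms and the projection onto the positive semidefinite cone -/

section Matrices

variable {n : ℕ}

theorem dotProduct_mulVec_eq_sum (A : Matrix (Fin n) (Fin n) ℝ) (u v : Fin n → ℝ) :
    u ⬝ᵥ A *ᵥ v = ∑ i, ∑ j, u i * A i j * v j := by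
  simp only [dotProduct, Matrix.mulVec, Finset.mul_sum, mul_assoc]

theorem frobNorm_sq (A : Matrix (Fin n) (Fin n) ℝ) : frobNorm A ^ 2 = ∑ i, ∑ j, A i j ^ 2 :=
  Real.sq_sqrt (Finset.sum_nonneg fun _ _ => Finset.sum_nonneg fun _ _ => sq_nonneg _)

theorem frobNorm_nonneg (A : Matrix (Fin n) (Fin n) ℝ) : 0 ≤ frobNorm A := Real.sqrt_nonneg _

theorem sum_sum_mul_mul_self_sq (v : Fin n → ℝ) :
    ∑ i, ∑ j, (v i * v j) ^ 2 = (v ⬝ᵥ v) ^ 2 := by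
  simp only [dotProduct, sq (∑ i, v i * v i), Finset.sum_mul_sum]
  exact Finset.sum_congr rfl fun i _ => Finset.sum_congr rfl fun j _ => by ring

theorem dotProduct_mulVec_le_frobNorm (A : Matrix (Fin n) (Fin n) ℝ) (v : Fin n → ℝ) :
    v ⬝ᵥ A *ᵥ v ≤ frobNorm A * (v ⬝ᵥ v) := by
  have hv : 0 ≤ v ⬝ᵥ v := Finset.sum_nonneg fun i _ => mul_self_nonneg _
  refine le_of_sq_le_sq ?_ (mul_nonneg (frobNorm_nonneg A) hv)
  have h := Finset.sum_mul_sq_le_sq_mul_sq (Finset.univ : Finset (Fin n × Fin n))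
    (fun p => A p.1 p.2) (fun p => v p.1 * v p.2)
  simp only [Fintype.sum_prod_type, sum_sum_mul_mul_self_sq, ← frobNorm_sq] at h
  rw [mul_pow, dotProduct_mulVec_eq_sum]
  refine le_of_eq_of_le ?_ h
  congr 1
  exact Finset.sum_congr rfl fun i _ => Finset.sum_congr rfl fun j _ => by ring

/-- First-order optimality of the projection: moving from the nearest point `P` along the ray
`P + t v vᵀ` inside the cone does not decrease the distance to `A`, so `A ⪯ P`. -/
theorem IsNearestPSD.dotProduct_mulVec_le {A P : Matrix (Fin n) (Fin n) ℝ} (h : IsNearestPSD A P)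
    (v : Fin n → ℝ) : v ⬝ᵥ A *ᵥ v ≤ v ⬝ᵥ P *ᵥ v := by
  set q := v ⬝ᵥ (A - P) *ᵥ v with hq
  set S := (v ⬝ᵥ v) ^ 2
  have hS : 0 ≤ S := sq_nonneg _
  have key : ∀ t : ℝ, 0 ≤ t → 2 * t * q ≤ t ^ 2 * S := by
    intro t ht
    have hQ : (P + t • Matrix.vecMulVec v (star v)).PosSemidef :=
      h.1.add ((Matrix.posSemidef_vecMulVec_self_star v).smul ht)
    have h1 := pow_le_pow_left₀ (frobNorm_nonneg _) (h.2 _ hQ) 2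
    have h2 : frobNorm (A - (P + t • Matrix.vecMulVec v (star v))) ^ 2
        = frobNorm (A - P) ^ 2 - 2 * t * q + t ^ 2 * S := by
      simp only [frobNorm_sq, hq, S, dotProduct_mulVec_eq_sum, ← sum_sum_mul_mul_self_sq,
        Finset.mul_sum, ← Finset.sum_sub_distrib, ← Finset.sum_add_distrib]
      refine Finset.sum_congr rfl fun i _ => Finset.sum_congr rfl fun j _ => ?_
      simp [Matrix.vecMulVec_apply]
      ring
    linarith
  have hq0 : q ≤ 0 := by
    by_contra! hpos
    have h3 := key (q / (S + 1)) (by positivity)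
    have h4 : q / (S + 1) * S ≤ q := by
      rw [div_mul_eq_mul_div, div_le_iff₀ (by positivity)]
      nlinarith
    have h5 : 0 < q / (S + 1) := by positivity
    nlinarith
  rw [Matrix.sub_mulVec, dotProduct_sub] at hq
  linarith

theorem dotProduct_mulVec_le_psdPart_frobNorm (A : Matrix (Fin n) (Fin n) ℝ) (v : Fin n → ℝ) :
    v ⬝ᵥ A *ᵥ v ≤ frobNorm (psdPart A) * (v ⬝ᵥ v) :=
  ((psdPart_spec A).dotProduct_mulVec_le v).trans (dotProduct_mulVec_le_frobNorm _ v)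

theorem metric_transpose (Θ : EuclideanSpace ℝ (Fin n) → ℝ → Matrix (Fin n) (Fin n) ℝ)
    (x : EuclideanSpace ℝ (Fin n)) (τ : ℝ) : (metric Θ x τ)ᵀ = metric Θ x τ := by
  simp [metric, Matrix.transpose_mul]

theorem metricDot_transpose (X : Set (EuclideanSpace ℝ (Fin n)))
    (b : ℝ → EuclideanSpace ℝ (Fin n) → EuclideanSpace ℝ (Fin n))
    (Θ : EuclideanSpace ℝ (Fin n) → ℝ → Matrix (Fin n) (Fin n) ℝ)
    (x : EuclideanSpace ℝ (Fin n)) (τ : ℝ) :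
    (metricDot X b Θ x τ)ᵀ = metricDot X b Θ x τ := by
  ext i j
  have h : ∀ p : EuclideanSpace ℝ (Fin n) × ℝ, metric Θ p.1 p.2 j i = metric Θ p.1 p.2 i j :=
    fun p => congrFun (congrFun (metric_transpose Θ p.1 p.2) i) j
  simp only [metricDot, Matrix.transpose_apply, Matrix.of_apply, h]

/-- A lower bound `m ≤ M(x, τ)` on the metric turns the Frobenius bound on the positive part of
the residual into the contraction inequality for the inflated rate. -/
theorem posSemidef_alphaTilde {X : Set (EuclideanSpace ℝ (Fin n))}
    {b : ℝ → EuclideanSpace ℝ (Fin n) → EuclideanSpace ℝ (Fin n)}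
    {Θ : EuclideanSpace ℝ (Fin n) → ℝ → Matrix (Fin n) (Fin n) ℝ} {m α : ℝ} (hm : 0 < m)
    (hMlow : ∀ x ∈ X, ∀ τ ∈ Icc (0 : ℝ) 1,
      (metric Θ x τ - m • (1 : Matrix (Fin n) (Fin n) ℝ)).PosSemidef)
    (hε : BddAbove (residualNorms X b Θ α)) {x : EuclideanSpace ℝ (Fin n)} (hx : x ∈ X) {τ : ℝ}
    (hτ : τ ∈ Icc (0 : ℝ) 1) :
    ((2 * alphaTilde X b Θ α m) • metric Θ x τ - (metricDot X b Θ x τ +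
      (2 : ℝ) • symPart (metric Θ x τ * jacobian X b x τ))).PosSemidef := by
  have hR : (2 * alphaTilde X b Θ α m) • metric Θ x τ - (metricDot X b Θ x τ +
      (2 : ℝ) • symPart (metric Θ x τ * jacobian X b x τ)) =
      (epsCtr X b Θ α / m) • metric Θ x τ - contractionResidual X b Θ α x τ := by
    have h2 : 2 * alphaTilde X b Θ α m = 2 * α + epsCtr X b Θ α / m := by
      rw [alphaTilde]; field_simp
    rw [h2, symPart, smul_smul, contractionResidual, Matrix.transpose_mul, metric_transpose,
      add_smul]
    norm_num
    abel
  rw [Matrix.posSemidef_iff_dotProduct_mulVec]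
  constructor
  · rw [Matrix.IsHermitian, Matrix.conjTranspose_eq_transpose_of_trivial]
    simp only [symPart, Matrix.transpose_sub, Matrix.transpose_smul, Matrix.transpose_add,
      metric_transpose, metricDot_transpose, Matrix.transpose_transpose]
    rw [add_comm (metric Θ x τ * _)ᵀ]
  · intro v
    rw [hR, star_trivial, Matrix.sub_mulVec, dotProduct_sub, sub_nonneg, Matrix.smul_mulVec,
      dotProduct_smul, smul_eq_mul]
    have hv : 0 ≤ v ⬝ᵥ v := Finset.sum_nonneg fun i _ => mul_self_nonneg _
    have h1 := dotProduct_mulVec_le_psdPart_frobNorm (contractionResidual X b Θ α x τ) v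
    have h2 : frobNorm (psdPart (contractionResidual X b Θ α x τ)) ≤ epsCtr X b Θ α :=
      le_csSup hε ⟨(x, τ), ⟨hx, hτ⟩, rfl⟩
    have h3 := ((Matrix.posSemidef_iff_dotProduct_mulVec).1 (hMlow x hx τ hτ)).2 v
    simp only [star_trivial, Matrix.sub_mulVec, dotProduct_sub, sub_nonneg, Matrix.smul_mulVec,
      dotProduct_smul, smul_eq_mul, Matrix.one_mulVec] at h3
    have h4 : 0 ≤ epsCtr X b Θ α := (frobNorm_nonneg _).trans h2
    calc _ ≤ epsCtr X b Θ α * (v ⬝ᵥ v) := h1.trans (by gcongr)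
      _ = epsCtr X b Θ α / m * (m * (v ⬝ᵥ v)) := by field_simp
      _ ≤ _ := by gcongr

end Matrices

/-! ### A local Grönwall inequality and uniform linearization along a trajectory -/

/-- A Grönwall inequality whose differential inequality is only known below the level `c`: if the
exponential bound starts below `c` with room to spare, the function never leaves that region. -/
theorem le_mul_exp_of_deriv_le_of_lt {f f' : ℝ → ℝ} {a b μ r c : ℝ}
    (hf : ContinuousOn f (Icc a b))
    (hf' : ∀ t ∈ Ico a b, HasDerivWithinAt f (f' t) (Ici t) t) (hf0 : 0 ≤ f a) (hμ : μ < r)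
    (hc : f a * Real.exp (|r| * (b - a)) < c)
    (bound : ∀ t ∈ Ico a b, f t < c → f' t ≤ μ * f t) {t : ℝ} (ht : t ∈ Icc a b) :
    f t ≤ f a * Real.exp (r * (t - a)) := by
  have hlim : Filter.Tendsto (fun η : ℝ => (f a + η) * Real.exp (|r| * (b - a)))
      (nhdsWithin 0 (Ioi 0)) (nhds ((f a + 0) * Real.exp (|r| * (b - a)))) :=
    (Continuous.tendsto (by fun_prop) 0).mono_left nhdsWithin_le_nhds
  rw [add_zero] at hlim
  have hlim' : Filter.Tendsto (fun η : ℝ => (f a + η) * Real.exp (r * (t - a)))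
      (nhdsWithin 0 (Ioi 0)) (nhds ((f a + 0) * Real.exp (r * (t - a)))) :=
    (Continuous.tendsto (by fun_prop) 0).mono_left nhdsWithin_le_nhds
  rw [add_zero] at hlim'
  refine ge_of_tendsto hlim' ?_
  filter_upwards [hlim.eventually (gt_mem_nhds hc), self_mem_nhdsWithin] with η hη hη0
  have hη0 : 0 < η := hη0
  have hB : ∀ u, HasDerivAt (fun u => (f a + η) * Real.exp (r * (u - a)))
      (r * ((f a + η) * Real.exp (r * (u - a)))) u := by
    intro u
    have h1 : HasDerivAt (fun u : ℝ => r * (u - a)) r u := by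
      simpa using ((hasDerivAt_id u).sub_const a).const_mul r
    exact (h1.exp.const_mul (f a + η)).congr_deriv (by ring)
  refine image_le_of_deriv_right_lt_deriv_boundary hf hf' ?_ hB ?_ ht
  · simp [hη0.le]
  · intro u hu hfu
    have hpos : 0 < f u := by rw [hfu]; positivity
    have hlt : f u < c := by
      rw [hfu]
      refine lt_of_le_of_lt ?_ hη
      have h2 : r * (u - a) ≤ |r| * (b - a) :=
        mul_le_mul (le_abs_self r) (by linarith [hu.2]) (by linarith [hu.1]) (abs_nonneg r)
      gcongr
    refine (bound u hu hlt).trans_lt ?_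
    rw [← hfu]
    exact mul_lt_mul_of_pos_right hμ hpos

/-- A function continuous on `X × [0, 1]` is uniformly continuous, within `X`, around a compact
trajectory. No compactness or closedness of `X` is needed. -/
theorem exists_tube {E H : Type*} [NormedAddCommGroup E] [PseudoMetricSpace H] {X : Set E}
    {F : E × ℝ → H} {p : ℝ → E} {s : ℝ} (hF : ContinuousOn F (X ×ˢ Icc (0 : ℝ) 1))
    (hs : 0 ≤ s) (hp : ContinuousOn p (Icc s 1))
    (hpX : ∀ t ∈ Icc s 1, p t ∈ X) {ε : ℝ} (hε : 0 < ε) :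
    ∃ δ > 0, ∀ t ∈ Icc s 1, ∀ z ∈ X, ‖z - p t‖ < δ → dist (F (p t, t)) (F (z, t)) < ε := by
  let γ : Icc s 1 → ↥(X ×ˢ Icc (0 : ℝ) 1) := fun t =>
    ⟨(p t, t), hpX t t.2, hs.trans t.2.1, t.2.2⟩
  have hγ : Continuous γ :=
    Continuous.subtype_mk ((continuousOn_iff_continuous_domRestrict.1 hp).prodMk
      continuous_subtype_val) _
  have hunif := (isCompact_range hγ).uniformContinuousAt_of_continuousAt
    ((X ×ˢ Icc (0 : ℝ) 1).domRestrict F)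
    (fun a _ => (continuousOn_iff_continuous_domRestrict.1 hF).continuousAt)
    (Metric.dist_mem_uniformity hε)
  obtain ⟨δ, hδ, h⟩ := Metric.mem_uniformity_dist.1 hunif
  refine ⟨δ, hδ, fun t ht z hz hzt => ?_⟩
  refine @h (γ ⟨t, ht⟩) ⟨(z, t), hz, hs.trans ht.1, ht.2⟩ ?_ ⟨⟨t, ht⟩, rfl⟩
  rw [Subtype.dist_eq, Prod.dist_eq]
  simpa [γ, dist_eq_norm, norm_sub_rev, hδ] using hzt

section Tube

variable {E G : Type*} [NormedAddCommGroup E] [NormedSpace ℝ E] [NormedAddCommGroup G]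
  [NormedSpace ℝ G] {X : Set E} {p : ℝ → E} {s : ℝ}

/-- Along a compact trajectory `p`, the field `b` is approximated by its linearization at `p t`
uniformly in `t`. -/
theorem exists_linearization {b : ℝ → E → G} (hX : Convex ℝ X)
    (hb : ∀ τ ∈ Icc (0 : ℝ) 1, DifferentiableOn ℝ (b τ) X)
    (hDb : ContinuousOn (fun q : E × ℝ => fderivWithin ℝ (b q.2) X q.1) (X ×ˢ Icc (0 : ℝ) 1))
    (hs : 0 ≤ s) (hp : ContinuousOn p (Icc s 1)) (hpX : ∀ t ∈ Icc s 1, p t ∈ X) {ε : ℝ}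
    (hε : 0 < ε) :
    ∃ δ > 0, ∀ t ∈ Icc s 1, ∀ z ∈ X, ‖z - p t‖ < δ →
      ‖b t z - b t (p t) - fderivWithin ℝ (b t) X (p t) (z - p t)‖ ≤ ε * ‖z - p t‖ := by
  obtain ⟨δ, hδ, h⟩ := exists_tube hDb hs hp hpX hε
  refine ⟨δ, hδ, fun t ht z hz hzt => ?_⟩
  have ht' : t ∈ Icc (0 : ℝ) 1 := ⟨hs.trans ht.1, ht.2⟩
  refine Convex.norm_image_sub_le_of_norm_hasFDerivWithin_le' (𝕜 := ℝ)
    (f' := fun y => fderivWithin ℝ (b t) X y) (s := X ∩ Metric.ball (p t) δ)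
    (fun y hy => ((hb t ht' y hy.1).hasFDerivWithinAt).mono inter_subset_left) ?_
    (hX.inter (convex_ball _ _)) ⟨hpX t ht, Metric.mem_ball_self hδ⟩
    ⟨hz, by rwa [Metric.mem_ball, dist_eq_norm]⟩
  intro y hy
  have := h t ht y hy.1 (by simpa [dist_eq_norm] using hy.2)
  rw [dist_eq_norm, norm_sub_rev] at this
  exact this.le

/-- A field with continuous Jacobian is Lipschitz, uniformly in time, between a compact trajectory
and the nearby points of `X`. -/
theorem exists_lipschitz_along {b : ℝ → E → G} (hX : Convex ℝ X)
    (hb : ∀ τ ∈ Icc (0 : ℝ) 1, DifferentiableOn ℝ (b τ) X)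
    (hDb : ContinuousOn (fun q : E × ℝ => fderivWithin ℝ (b q.2) X q.1) (X ×ˢ Icc (0 : ℝ) 1))
    (hs : 0 ≤ s) (hp : ContinuousOn p (Icc s 1)) (hpX : ∀ t ∈ Icc s 1, p t ∈ X) :
    ∃ δ > 0, ∃ L > 0, ∀ t ∈ Icc s 1, ∀ z ∈ X, ‖z - p t‖ < δ →
      ‖b t z - b t (p t)‖ ≤ L * ‖z - p t‖ := by
  obtain ⟨δ, hδ, h⟩ := exists_linearization hX hb hDb hs hp hpX one_pos
  have hcont : ContinuousOn (fun t => fderivWithin ℝ (b t) X (p t)) (Icc s 1) :=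
    hDb.comp (hp.prodMk continuousOn_id) fun t ht => ⟨hpX t ht, hs.trans ht.1, ht.2⟩
  obtain ⟨C, hC⟩ := isCompact_Icc.exists_bound_of_continuousOn hcont
  refine ⟨δ, hδ, |C| + 1, by positivity, fun t ht z hz hzt => ?_⟩
  have h1 := h t ht z hz hzt
  have h2 : ‖fderivWithin ℝ (b t) X (p t) (z - p t)‖ ≤ |C| * ‖z - p t‖ :=
    (ContinuousLinearMap.le_opNorm _ _).trans
      (mul_le_mul_of_nonneg_right ((hC t ht).trans (le_abs_self C)) (norm_nonneg _))
  calc ‖b t z - b t (p t)‖ = ‖(b t z - b t (p t) - fderivWithin ℝ (b t) X (p t) (z - p t)) +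
        fderivWithin ℝ (b t) X (p t) (z - p t)‖ := by rw [sub_add_cancel]
    _ ≤ 1 * ‖z - p t‖ + |C| * ‖z - p t‖ := (norm_add_le _ _).trans (add_le_add h1 h2)
    _ = _ := by ring

end Tube

/-! ### Contracting fields and their trajectories -/

section Contraction

variable {n : ℕ}

/-- The field `b` is contracting on `X` at rate `a` in the metric `M = ΘᵀΘ`: it has a continuous
Jacobian, `m I ⪯ M ⪯ M' I`, and `Ṁ + 2 sym (M Db) ⪯ 2 a M`. -/
structure IsContracting (X : Set (EuclideanSpace ℝ (Fin n)))
    (b : ℝ → EuclideanSpace ℝ (Fin n) → EuclideanSpace ℝ (Fin n))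
    (Θ : EuclideanSpace ℝ (Fin n) → ℝ → Matrix (Fin n) (Fin n) ℝ) (m M' a : ℝ) : Prop where
  convex : Convex ℝ X
  diff : ∀ τ ∈ Icc (0 : ℝ) 1, DifferentiableOn ℝ (b τ) X
  continuousOn_fderiv : ContinuousOn
    (fun p : EuclideanSpace ℝ (Fin n) × ℝ => fderivWithin ℝ (b p.2) X p.1) (X ×ˢ Icc (0 : ℝ) 1)
  metric_diff : ∀ i j, DifferentiableOn ℝ
    (fun p : EuclideanSpace ℝ (Fin n) × ℝ => metric Θ p.1 p.2 i j) (X ×ˢ Icc (0 : ℝ) 1)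
  pos : 0 < m
  lower : ∀ x ∈ X, ∀ τ ∈ Icc (0 : ℝ) 1,
    (metric Θ x τ - m • (1 : Matrix (Fin n) (Fin n) ℝ)).PosSemidef
  upper : ∀ x ∈ X, ∀ τ ∈ Icc (0 : ℝ) 1,
    (M' • (1 : Matrix (Fin n) (Fin n) ℝ) - metric Θ x τ).PosSemidef
  contracts : ∀ x ∈ X, ∀ τ ∈ Icc (0 : ℝ) 1,
    ((2 * a) • metric Θ x τ - (metricDot X b Θ x τ +
      (2 : ℝ) • symPart (metric Θ x τ * jacobian X b x τ))).PosSemidef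

/-- `p` is a trajectory of `b` in `X` over the time interval `[s, 1]`. -/
structure IsTrajectory (X : Set (EuclideanSpace ℝ (Fin n)))
    (b : ℝ → EuclideanSpace ℝ (Fin n) → EuclideanSpace ℝ (Fin n)) (s : ℝ)
    (p : ℝ → EuclideanSpace ℝ (Fin n)) : Prop where
  mem : ∀ t ∈ Icc s 1, p t ∈ X
  deriv : ∀ t ∈ Icc s 1, HasDerivWithinAt p (b t (p t)) (Icc s 1) t

variable {X : Set (EuclideanSpace ℝ (Fin n))}
  {b : ℝ → EuclideanSpace ℝ (Fin n) → EuclideanSpace ℝ (Fin n)}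
  {Θ : EuclideanSpace ℝ (Fin n) → ℝ → Matrix (Fin n) (Fin n) ℝ} {m M' a s : ℝ}
  {p q : ℝ → EuclideanSpace ℝ (Fin n)}

theorem IsTrajectory.continuousOn (hp : IsTrajectory X b s p) : ContinuousOn p (Icc s 1) :=
  fun t ht => (hp.deriv t ht).continuousWithinAt

theorem IsTrajectory.mono (hp : IsTrajectory X b s p) {t : ℝ} (hst : s ≤ t) :
    IsTrajectory X b t p :=
  ⟨fun r hr => hp.mem r ⟨hst.trans hr.1, hr.2⟩, fun r hr =>
    (hp.deriv r ⟨hst.trans hr.1, hr.2⟩).mono (Icc_subset_Icc_left hst)⟩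

theorem _root_.HasDerivWithinAt.Ici_of_Icc {F : Type*} [NormedAddCommGroup F] [NormedSpace ℝ F]
    {f : ℝ → F} {f' : F} {a b t : ℝ} (h : HasDerivWithinAt f f' (Icc a b) t) (ht : t ∈ Ico a b) :
    HasDerivWithinAt f f' (Ici t) t :=
  (h.mono (Icc_subset_Icc_left ht.1)).mono_of_mem_nhdsWithin (Icc_mem_nhdsGE ht.2)

theorem IsTwoTimeFlow.isTrajectory {Φ : ℝ → ℝ → X → X} (h : IsTwoTimeFlow X b Φ)
    (hs : s ∈ Icc (0 : ℝ) 1) (x : X) :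
    IsTrajectory X b s fun t => (Φ s t x : EuclideanSpace ℝ (Fin n)) :=
  ⟨fun t _ => (Φ s t x).2, fun t ht => h.deriv s hs t ht x⟩

theorem norm_sq_eq_dotProduct (v : EuclideanSpace ℝ (Fin n)) : ‖v‖ ^ 2 = v.ofLp ⬝ᵥ v.ofLp := by
  rw [EuclideanSpace.norm_sq_eq]
  simp [dotProduct, sq]

theorem IsContracting.le_dotProduct (h : IsContracting X b Θ m M' a)
    {x : EuclideanSpace ℝ (Fin n)} (hx : x ∈ X) {τ : ℝ} (hτ : τ ∈ Icc (0 : ℝ) 1)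
    (v : EuclideanSpace ℝ (Fin n)) : m * ‖v‖ ^ 2 ≤ v.ofLp ⬝ᵥ metric Θ x τ *ᵥ v.ofLp := by
  have h3 := ((Matrix.posSemidef_iff_dotProduct_mulVec).1 (h.lower x hx τ hτ)).2 v.ofLp
  simpa only [star_trivial, Matrix.sub_mulVec, dotProduct_sub, sub_nonneg, Matrix.smul_mulVec,
      dotProduct_smul, smul_eq_mul, Matrix.one_mulVec, ← norm_sq_eq_dotProduct] using h3

theorem IsContracting.dotProduct_le (h : IsContracting X b Θ m M' a)
    {x : EuclideanSpace ℝ (Fin n)} (hx : x ∈ X) {τ : ℝ} (hτ : τ ∈ Icc (0 : ℝ) 1)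
    (v : EuclideanSpace ℝ (Fin n)) : v.ofLp ⬝ᵥ metric Θ x τ *ᵥ v.ofLp ≤ M' * ‖v‖ ^ 2 := by
  have h3 := ((Matrix.posSemidef_iff_dotProduct_mulVec).1 (h.upper x hx τ hτ)).2 v.ofLp
  simpa only [star_trivial, Matrix.sub_mulVec, dotProduct_sub, sub_nonneg, Matrix.smul_mulVec,
      dotProduct_smul, smul_eq_mul, Matrix.one_mulVec, ← norm_sq_eq_dotProduct] using h3

theorem dotProduct_metric_comm (x : EuclideanSpace ℝ (Fin n)) (τ : ℝ) (v w : Fin n → ℝ) :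
    v ⬝ᵥ metric Θ x τ *ᵥ w = w ⬝ᵥ metric Θ x τ *ᵥ v := by
  rw [Matrix.dotProduct_mulVec, ← Matrix.mulVec_transpose, metric_transpose, dotProduct_comm]

theorem IsContracting.dotProduct_deriv_le (h : IsContracting X b Θ m M' a)
    {x : EuclideanSpace ℝ (Fin n)} (hx : x ∈ X) {τ : ℝ} (hτ : τ ∈ Icc (0 : ℝ) 1)
    (v : Fin n → ℝ) :
    v ⬝ᵥ metricDot X b Θ x τ *ᵥ v + 2 * ((jacobian X b x τ *ᵥ v) ⬝ᵥ metric Θ x τ *ᵥ v) ≤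
      2 * a * (v ⬝ᵥ metric Θ x τ *ᵥ v) := by
  have h3 := ((Matrix.posSemidef_iff_dotProduct_mulVec).1 (h.contracts x hx τ hτ)).2 v
  have h4 : v ⬝ᵥ (metric Θ x τ * jacobian X b x τ)ᵀ *ᵥ v =
      v ⬝ᵥ (metric Θ x τ * jacobian X b x τ) *ᵥ v := by
    rw [Matrix.mulVec_transpose, dotProduct_comm, Matrix.dotProduct_mulVec]
  have h5 : v ⬝ᵥ (metric Θ x τ * jacobian X b x τ) *ᵥ v =
      (jacobian X b x τ *ᵥ v) ⬝ᵥ metric Θ x τ *ᵥ v := by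
    rw [← Matrix.mulVec_mulVec, dotProduct_metric_comm]
  simp only [star_trivial, Matrix.sub_mulVec, dotProduct_sub, sub_nonneg, Matrix.smul_mulVec,
      dotProduct_smul, smul_eq_mul, symPart, Matrix.add_mulVec, dotProduct_add, h4, h5] at h3
  linarith

theorem jacobian_mulVec (x v : EuclideanSpace ℝ (Fin n)) (τ : ℝ) :
    (fderivWithin ℝ (b τ) X x v).ofLp = jacobian X b x τ *ᵥ v.ofLp := by
  ext i
  conv_lhs => rw [← (EuclideanSpace.basisFun (Fin n) ℝ).sum_repr v]
  simp [jacobian, Matrix.mulVec, dotProduct, mul_comm]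

/-- The derivative of the energy `(q - p)ᵀ M(p, t) (q - p)` of a pair of trajectories; the field at
`q` enters through its difference from the linearization at `p`. -/
theorem hasDerivWithinAt_energy
    (hM : ∀ i j, DifferentiableOn ℝ
      (fun p : EuclideanSpace ℝ (Fin n) × ℝ => metric Θ p.1 p.2 i j) (X ×ˢ Icc (0 : ℝ) 1))
    (hs : 0 ≤ s) (hp : IsTrajectory X b s p) (hq : IsTrajectory X b s q) {t : ℝ}
    (ht : t ∈ Icc s 1) :
    HasDerivWithinAt (fun t => (q t - p t).ofLp ⬝ᵥ metric Θ (p t) t *ᵥ (q t - p t).ofLp)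
      ((q t - p t).ofLp ⬝ᵥ metricDot X b Θ (p t) t *ᵥ (q t - p t).ofLp +
        2 * ((jacobian X b (p t) t *ᵥ (q t - p t).ofLp) ⬝ᵥ
          metric Θ (p t) t *ᵥ (q t - p t).ofLp) +
        2 * ((b t (q t) - b t (p t) - fderivWithin ℝ (b t) X (p t) (q t - p t)).ofLp ⬝ᵥ
          metric Θ (p t) t *ᵥ (q t - p t).ofLp)) (Icc s 1) t := by
  have hv : ∀ i, HasDerivWithinAt (fun t => (q t - p t).ofLp i)
      ((b t (q t) - b t (p t)).ofLp i) (Icc s 1) t := fun i =>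
    (EuclideanSpace.proj (𝕜 := ℝ) i).hasFDerivAt.comp_hasDerivWithinAt t
      ((hq.deriv t ht).sub (hp.deriv t ht))
  have hMt : ∀ i j, HasDerivWithinAt (fun t => metric Θ (p t) t i j)
      (metricDot X b Θ (p t) t i j) (Icc s 1) t := fun i j =>
    HasFDerivWithinAt.comp_hasDerivWithinAt (f := fun t => (p t, t)) t
      (hM i j (p t, t) ⟨hp.mem t ht, hs.trans ht.1, ht.2⟩).hasFDerivWithinAt
      ((hp.deriv t ht).prodMk (hasDerivWithinAt_id t _))
      (fun r hr => ⟨hp.mem r hr, hs.trans hr.1, hr.2⟩)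
  have hE := HasDerivWithinAt.fun_sum (u := Finset.univ) fun i _ =>
    HasDerivWithinAt.fun_sum (u := Finset.univ) fun j _ => ((hv i).fun_mul (hMt i j)).fun_mul (hv j)
  simp only [dotProduct_mulVec_eq_sum]
  refine hE.congr_deriv ?_
  simp only [← dotProduct_mulVec_eq_sum, ← jacobian_mulVec]
  have h1 : (b t (q t) - b t (p t)).ofLp = (fderivWithin ℝ (b t) X (p t) (q t - p t)).ofLp +
      (b t (q t) - b t (p t) - fderivWithin ℝ (b t) X (p t) (q t - p t)).ofLp := by
    simp
  have h2 : ∀ u v : Fin n → ℝ, ∀ A B : Matrix (Fin n) (Fin n) ℝ,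
      ∑ i, ∑ j, ((u i * A i j + v i * B i j) * v j + v i * A i j * u j) =
      u ⬝ᵥ A *ᵥ v + v ⬝ᵥ B *ᵥ v + v ⬝ᵥ A *ᵥ u := fun u v A B => by
    simp only [dotProduct_mulVec_eq_sum, ← Finset.sum_add_distrib]
    exact Finset.sum_congr rfl fun i _ => Finset.sum_congr rfl fun j _ => by ring
  rw [h2, dotProduct_metric_comm (p t) t (q t - p t).ofLp (b t (q t) - b t (p t)).ofLp, h1,
    add_dotProduct]
  ring

/-- Young's inequality in the inner product given by the metric. -/
theorem two_mul_dotProduct_metric_le (x : EuclideanSpace ℝ (Fin n)) (τ : ℝ) (w v : Fin n → ℝ)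
    {c : ℝ} (hc : 0 < c) :
    2 * (w ⬝ᵥ metric Θ x τ *ᵥ v) ≤
      c * (v ⬝ᵥ metric Θ x τ *ᵥ v) + c⁻¹ * (w ⬝ᵥ metric Θ x τ *ᵥ w) := by
  have h0 : ∀ u : Fin n → ℝ, 0 ≤ u ⬝ᵥ metric Θ x τ *ᵥ u := fun u => by
    rw [metric, ← Matrix.mulVec_mulVec, Matrix.dotProduct_mulVec, Matrix.vecMul_transpose]
    exact Finset.sum_nonneg fun i _ => mul_self_nonneg _
  have h1 := h0 (c • v - w)
  simp only [Matrix.mulVec_sub, Matrix.mulVec_smul, dotProduct_sub, sub_dotProduct,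
    dotProduct_smul, smul_dotProduct, smul_eq_mul, dotProduct_metric_comm x τ v w] at h1
  have h2 : 0 ≤ c⁻¹ * (c * (c * (v ⬝ᵥ metric Θ x τ *ᵥ v)) -
      2 * (c * (w ⬝ᵥ metric Θ x τ *ᵥ v)) + w ⬝ᵥ metric Θ x τ *ᵥ w) :=
    mul_nonneg (by positivity) (by linarith)
  have h3 : c⁻¹ * (c * (c * (v ⬝ᵥ metric Θ x τ *ᵥ v)) -
      2 * (c * (w ⬝ᵥ metric Θ x τ *ᵥ v)) + w ⬝ᵥ metric Θ x τ *ᵥ w) =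
      c * (v ⬝ᵥ metric Θ x τ *ᵥ v) - 2 * (w ⬝ᵥ metric Θ x τ *ᵥ v) +
        c⁻¹ * (w ⬝ᵥ metric Θ x τ *ᵥ w) := by
    field_simp
  linarith

/-- Two trajectories that start close together separate at most at the rate `a + 2 ε`. Since
`q s = p s` is allowed, this contains the uniqueness of trajectories. -/
theorem IsContracting.exists_local_bound (h : IsContracting X b Θ m M' a) (hs : 0 ≤ s)
    (hp : IsTrajectory X b s p) {ε : ℝ} (hε : 0 < ε) :
    ∃ δ > 0, ∀ q, IsTrajectory X b s q → ‖q s - p s‖ < δ → ∀ t ∈ Icc s 1,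
      ‖q t - p t‖ ≤ kappa m M' * Real.exp ((a + 2 * ε) * (t - s)) * ‖q s - p s‖ := by
  have hm := h.pos
  set L := |M'| + m with hL
  have hLpos : 0 < L := by positivity
  have hML : M' ≤ L := (le_abs_self M').trans (by linarith)
  have hmL : m ≤ L := by linarith [abs_nonneg M']
  -- this accuracy of the linearization makes the error term at most `2 ε` times the energy
  obtain ⟨δ₀, hδ₀, hlin⟩ := exists_linearization h.convex h.diff h.continuousOn_fderiv hs
    hp.continuousOn hp.mem (show 0 < ε * m / L by positivity)
  set r := 2 * (a + 2 * ε) with hr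
  set K := Real.exp (|r| * (1 - s)) with hK
  have hKpos : 0 < K := Real.exp_pos _
  -- starting this close keeps the exponential bound for the energy below `m δ₀ ^ 2` up to time `1`,
  -- hence the two trajectories within `δ₀`, where the linearization is accurate
  refine ⟨min 1 (m * δ₀ ^ 2 / (2 * L * K)), by positivity, fun q hq hqp t ht => ?_⟩
  have h01 : ∀ u ∈ Icc s 1, u ∈ Icc (0 : ℝ) 1 := fun u hu => ⟨hs.trans hu.1, hu.2⟩
  have hsI : s ∈ Icc s 1 := ⟨le_rfl, ht.1.trans ht.2⟩
  set f : ℝ → ℝ := fun t => (q t - p t).ofLp ⬝ᵥ metric Θ (p t) t *ᵥ (q t - p t).ofLp with hf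
  have hlow : ∀ u ∈ Icc s 1, m * ‖q u - p u‖ ^ 2 ≤ f u := fun u hu =>
    h.le_dotProduct (hp.mem u hu) (h01 u hu) _
  have hfd := fun u (hu : u ∈ Icc s 1) => hasDerivWithinAt_energy h.metric_diff hs hp hq hu
  have hup : f s ≤ M' * ‖q s - p s‖ ^ 2 := h.dotProduct_le (hp.mem s hsI) (h01 s hsI) _
  have hstart : f s * Real.exp (|r| * (1 - s)) < m * δ₀ ^ 2 := by
    rw [← hK]
    have h1 : ‖q s - p s‖ ^ 2 ≤ m * δ₀ ^ 2 / (2 * L * K) := by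
      have h2 : ‖q s - p s‖ ≤ 1 := (hqp.trans_le (min_le_left _ _)).le
      have h3 : ‖q s - p s‖ ≤ m * δ₀ ^ 2 / (2 * L * K) := (hqp.trans_le (min_le_right _ _)).le
      nlinarith [norm_nonneg (q s - p s)]
    calc f s * K ≤ L * (m * δ₀ ^ 2 / (2 * L * K)) * K := by
          gcongr
          exact hup.trans (by gcongr)
      _ = m * δ₀ ^ 2 / 2 := by field_simp
      _ < m * δ₀ ^ 2 := half_lt_self (by positivity)
  have hmain : f t ≤ f s * Real.exp (r * (t - s)) := by
    refine le_mul_exp_of_deriv_le_of_lt (μ := 2 * (a + ε))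
      (fun u hu => (hfd u hu).continuousWithinAt)
      (fun u hu => (hfd u (Ico_subset_Icc_self hu)).Ici_of_Icc hu)
      (le_trans (by positivity) (hlow s hsI)) (by rw [hr]; linarith) hstart ?_ ht
    intro u hu' hfu
    have hu := Ico_subset_Icc_self hu'
    have hclose : ‖q u - p u‖ < δ₀ := by
      refine lt_of_pow_lt_pow_left₀ 2 hδ₀.le ?_
      exact lt_of_mul_lt_mul_left ((hlow u hu).trans_lt hfu) hm.le
    have hw := hlin u hu (q u) (hq.mem u hu) hclose
    set w := b u (q u) - b u (p u) - fderivWithin ℝ (b u) X (p u) (q u - p u)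
    have h1 := h.dotProduct_deriv_le (hp.mem u hu) (h01 u hu) (q u - p u).ofLp
    have h2 := two_mul_dotProduct_metric_le (Θ := Θ) (p u) u w.ofLp (q u - p u).ofLp hε
    have h3 : w.ofLp ⬝ᵥ metric Θ (p u) u *ᵥ w.ofLp ≤ ε ^ 2 * f u :=
      calc _ ≤ M' * ‖w‖ ^ 2 := h.dotProduct_le (hp.mem u hu) (h01 u hu) _
        _ ≤ L * (ε * m / L * ‖q u - p u‖) ^ 2 := by gcongr
        _ = m / L * (ε ^ 2 * (m * ‖q u - p u‖ ^ 2)) := by field_simp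
        _ ≤ 1 * (ε ^ 2 * (m * ‖q u - p u‖ ^ 2)) := by
          gcongr
          exact (div_le_one hLpos).2 hmL
        _ ≤ ε ^ 2 * f u := by
          rw [one_mul]
          gcongr
          exact hlow u hu
    have h4 : ε⁻¹ * (w.ofLp ⬝ᵥ metric Θ (p u) u *ᵥ w.ofLp) ≤ ε * f u :=
      calc _ ≤ ε⁻¹ * (ε ^ 2 * f u) := by gcongr
        _ = ε * f u := by field_simp
    have h5 : f u = (q u - p u).ofLp ⬝ᵥ metric Θ (p u) u *ᵥ (q u - p u).ofLp := rfl
    rw [← h5] at h1 h2 ⊢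
    linarith
  have hsq : ‖q t - p t‖ ^ 2 ≤
      M' / m * (Real.exp ((a + 2 * ε) * (t - s)) * ‖q s - p s‖) ^ 2 := by
    have h1 : m * ‖q t - p t‖ ^ 2 ≤ M' * ‖q s - p s‖ ^ 2 * Real.exp (r * (t - s)) :=
      (hlow t ht).trans (hmain.trans (by gcongr))
    have h2 : Real.exp (r * (t - s)) = Real.exp ((a + 2 * ε) * (t - s)) ^ 2 := by
      rw [← Real.exp_nat_mul, hr]; congr 1; push_cast; ring
    rw [h2] at h1
    rw [div_mul_eq_mul_div, le_div_iff₀ hm]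
    linarith
  -- `M' / m` may be negative when `n = 0`; `Real.sqrt_mul'` only needs the square nonnegative
  calc ‖q t - p t‖ ≤ √(M' / m * (Real.exp ((a + 2 * ε) * (t - s)) * ‖q s - p s‖) ^ 2) :=
        Real.le_sqrt_of_sq_le hsq
    _ = _ := by
      rw [Real.sqrt_mul' _ (sq_nonneg _), Real.sqrt_sq (by positivity), kappa, mul_assoc]

theorem IsContracting.trajectory_unique (h : IsContracting X b Θ m M' a) (hs : 0 ≤ s)
    (hp : IsTrajectory X b s p) (hq : IsTrajectory X b s q) (hqp : q s = p s) {t : ℝ}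
    (ht : t ∈ Icc s 1) : q t = p t := by
  obtain ⟨δ, hδ, hb⟩ := h.exists_local_bound hs hp one_pos
  have := hb q hq (by simpa [hqp] using hδ) t ht
  rw [hqp, sub_self, norm_zero, mul_zero] at this
  exact sub_eq_zero.1 (norm_le_zero_iff.1 this)

end Contraction

/-! ### Global Lipschitz bound for the flow of a contracting field -/

open Filter Topology in
/-- A mean value inequality for a continuous curve whose increments to the right are controlled by
the derivative of `B`. -/
theorem norm_sub_le_of_eventually_norm_sub_le {E : Type*} [NormedAddCommGroup E] [NormedSpace ℝ E]
    {f : ℝ → E} {B B' : ℝ → ℝ} {a b : ℝ} (hab : a ≤ b) (hf : ContinuousOn f (Icc a b))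
    (hB : ∀ u, HasDerivAt B (B' u) u)
    (h : ∀ u ∈ Ico a b, ∀ r, B' u < r → ∀ᶠ z in 𝓝[>] u, ‖f z - f u‖ ≤ r * (z - u)) :
    ‖f b - f a‖ ≤ B b - B a := by
  refine image_le_of_liminf_slope_right_le_deriv_boundary (f := fun u => ‖f u - f a‖)
    (B := fun u => B u - B a) (B' := B') (hf.sub continuousOn_const).norm (by simp)
    (fun u _ => ((hB u).sub_const _).continuousAt.continuousWithinAt)
    (fun u _ => ((hB u).sub_const _).hasDerivWithinAt) ?_ (right_mem_Icc.2 hab)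
  intro u hu r hr
  obtain ⟨r', hr', hr'r⟩ := exists_between hr
  refine Eventually.frequently ?_
  filter_upwards [h u hu r' hr', self_mem_nhdsWithin] with z hz hzu
  have hzu : 0 < z - u := sub_pos.2 hzu
  rw [slope_def_field, div_lt_iff₀ hzu]
  have h1 : ‖f z - f a‖ - ‖f u - f a‖ ≤ ‖f z - f u‖ := by
    simpa using norm_sub_norm_le (f z - f a) (f u - f a)
  have h2 : r' * (z - u) < r * (z - u) := mul_lt_mul_of_pos_right hr'r hzu
  linarith

/-- On a convex set, a pointwise local Lipschitz bound with constant `C` is a global one. -/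
theorem norm_sub_le_of_local_bound {E F : Type*} [NormedAddCommGroup E] [NormedSpace ℝ E]
    [NormedAddCommGroup F] [NormedSpace ℝ F] {X : Set E} (hX : Convex ℝ X) {G : X → F} {C : ℝ}
    (hG : ∀ x : X, ∃ δ > 0, ∀ y : X, ‖(y : E) - x‖ < δ → ‖G y - G x‖ ≤ C * ‖(y : E) - x‖)
    (x y : X) : ‖G y - G x‖ ≤ C * ‖(y : E) - x‖ := by
  let γ : ℝ → X := fun u =>
    ⟨AffineMap.lineMap (x : E) (y : E) (projIcc (0 : ℝ) 1 zero_le_one u : ℝ),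
    hX.lineMap_mem x.2 y.2 (projIcc (0 : ℝ) 1 zero_le_one u).2⟩
  have hγ : ∀ u ∈ Icc (0 : ℝ) 1, ∀ z ∈ Icc (0 : ℝ) 1,
      ‖(γ z : E) - γ u‖ = |z - u| * ‖(y : E) - x‖ := by
    intro u hu z hz
    simp only [γ, projIcc_of_mem _ hu, projIcc_of_mem _ hz]
    rw [← dist_eq_norm, dist_lineMap_lineMap, Real.dist_eq, dist_comm, dist_eq_norm]
  have hγ0 : γ 0 = x := Subtype.ext (by simp [γ])
  have hγ1 : γ 1 = y := Subtype.ext (by simp [γ])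
  have hloc : ∀ u ∈ Icc (0 : ℝ) 1, ∃ η > 0, ∀ z ∈ Icc (0 : ℝ) 1, |z - u| < η →
      ‖G (γ z) - G (γ u)‖ ≤ C * ‖(y : E) - x‖ * |z - u| := by
    intro u hu
    obtain ⟨δ, hδ, h⟩ := hG (γ u)
    refine ⟨δ / (‖(y : E) - x‖ + 1), by positivity, fun z hz hzu => ?_⟩
    have h1 : ‖(γ z : E) - γ u‖ < δ := by
      rw [hγ u hu z hz]
      rw [lt_div_iff₀ (by positivity)] at hzu
      nlinarith [abs_nonneg (z - u)]
    have h2 := h _ h1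
    rw [hγ u hu z hz] at h2
    linarith
  have hcont : ContinuousOn (fun u => G (γ u)) (Icc 0 1) := by
    intro u hu
    obtain ⟨η, hη, h⟩ := hloc u hu
    refine tendsto_iff_norm_sub_tendsto_zero.2 (squeeze_zero' (Filter.Eventually.of_forall
      fun _ => norm_nonneg _) (g := fun z => C * ‖(y : E) - x‖ * |z - u|) ?_ ?_)
    · filter_upwards [self_mem_nhdsWithin, mem_nhdsWithin_of_mem_nhds (Metric.ball_mem_nhds u hη)]
        with z hz hzu
      exact h z hz (by simpa [Real.dist_eq] using hzu)
    · have : Filter.Tendsto (fun z => C * ‖(y : E) - x‖ * |z - u|) (nhds u)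
          (nhds (C * ‖(y : E) - x‖ * |u - u|)) := Continuous.tendsto (by fun_prop) u
      rw [sub_self, abs_zero, mul_zero] at this
      exact this.mono_left nhdsWithin_le_nhds
  have hmain := norm_sub_le_of_eventually_norm_sub_le (f := fun u => G (γ u))
    (B := fun u => C * ‖(y : E) - x‖ * u) (B' := fun _ => C * ‖(y : E) - x‖) zero_le_one hcont
    (fun u => by simpa using (hasDerivAt_id u).const_mul (C * ‖(y : E) - x‖)) ?_
  · simpa [hγ0, hγ1] using hmain
  · intro u hu r hr
    obtain ⟨η, hη, h⟩ := hloc u (Ico_subset_Icc_self hu)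
    filter_upwards [Ioo_mem_nhdsGT (show u < min 1 (u + η) from lt_min hu.2 (by linarith))]
      with z hz
    have hz1 : z < 1 := hz.2.trans_le (min_le_left _ _)
    have hz2 : z < u + η := hz.2.trans_le (min_le_right _ _)
    have hzu : 0 < z - u := sub_pos.2 hz.1
    have h1 := h z ⟨by linarith [hu.1], hz1.le⟩ (by rw [abs_of_pos hzu]; linarith)
    rw [abs_of_pos hzu] at h1
    exact h1.trans (by gcongr)

section Flow

variable {n : ℕ} {X : Set (EuclideanSpace ℝ (Fin n))}
  {b : ℝ → EuclideanSpace ℝ (Fin n) → EuclideanSpace ℝ (Fin n)}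
  {Θ : EuclideanSpace ℝ (Fin n) → ℝ → Matrix (Fin n) (Fin n) ℝ} {m M' a s t : ℝ}
  {Φ : ℝ → ℝ → X → X}

theorem kappa_nonneg (m M : ℝ) : 0 ≤ kappa m M := Real.sqrt_nonneg _

theorem IsContracting.flow_norm_sub_le (h : IsContracting X b Θ m M' a) (hΦ : IsTwoTimeFlow X b Φ)
    (hs : s ∈ Icc (0 : ℝ) 1) (ht : t ∈ Icc s 1) (x y : X) :
    ‖(Φ s t y : EuclideanSpace ℝ (Fin n)) - Φ s t x‖ ≤
      kappa m M' * Real.exp (a * (t - s)) * ‖(y : EuclideanSpace ℝ (Fin n)) - x‖ := by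
  have key : ∀ ε > 0, ‖(Φ s t y : EuclideanSpace ℝ (Fin n)) - Φ s t x‖ ≤
      kappa m M' * Real.exp ((a + 2 * ε) * (t - s)) *
        ‖(y : EuclideanSpace ℝ (Fin n)) - x‖ := by
    intro ε hε
    refine norm_sub_le_of_local_bound h.convex
      (G := fun x => (Φ s t x : EuclideanSpace ℝ (Fin n)))
      (fun x => ?_) x y
    obtain ⟨δ, hδ, hloc⟩ := h.exists_local_bound hs.1 (hΦ.isTrajectory hs x) hε
    refine ⟨δ, hδ, fun y hy => ?_⟩
    have h1 := hloc _ (hΦ.isTrajectory hs y)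
    simp only [hΦ.self s hs] at h1
    exact h1 hy t ht
  have hlim : Filter.Tendsto (fun ε : ℝ => kappa m M' * Real.exp ((a + 2 * ε) * (t - s)) *
        ‖(y : EuclideanSpace ℝ (Fin n)) - x‖) (nhdsWithin 0 (Ioi 0))
      (nhds (kappa m M' * Real.exp ((a + 2 * 0) * (t - s)) *
        ‖(y : EuclideanSpace ℝ (Fin n)) - x‖)) :=
    (Continuous.tendsto (by fun_prop) 0).mono_left nhdsWithin_le_nhds
  rw [mul_zero, add_zero] at hlim
  exact ge_of_tendsto hlim (by filter_upwards [self_mem_nhdsWithin] with ε hε using key ε hε)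

theorem IsContracting.flow_comp (h : IsContracting X b Θ m M' a) (hΦ : IsTwoTimeFlow X b Φ)
    (hs : s ∈ Icc (0 : ℝ) 1) (ht : t ∈ Icc s 1) {τ : ℝ} (hτ : τ ∈ Icc t 1) (x : X) :
    Φ t τ (Φ s t x) = Φ s τ x := by
  have ht0 : t ∈ Icc (0 : ℝ) 1 := ⟨hs.1.trans ht.1, ht.2⟩
  exact Subtype.ext (h.trajectory_unique ht0.1 ((hΦ.isTrajectory hs x).mono ht.1)
    (hΦ.isTrajectory ht0 (Φ s t x)) (congrArg Subtype.val (hΦ.self t ht0 (Φ s t x))) hτ)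

/-! ### Comparison with a perturbed flow -/

/-- Started on a trajectory `q` of the perturbed field, a trajectory of `b` stays within
`(D + ε) (t - s)` of `q` for short times, uniformly in the starting time `s`. -/
theorem IsContracting.exists_consistency (h : IsContracting X b Θ m M' a)
    {d : ℝ → EuclideanSpace ℝ (Fin n) → EuclideanSpace ℝ (Fin n)} {D : ℝ} (hD0 : 0 ≤ D)
    (hD : ∀ x ∈ X, ∀ τ ∈ Icc (0 : ℝ) 1, ‖d τ x‖ ≤ D)
    {q : ℝ → EuclideanSpace ℝ (Fin n)} (hq : IsTrajectory X (fun τ x => b τ x + d τ x) 0 q)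
    {ε : ℝ} (hε : 0 < ε) :
    ∃ h₀ > 0, ∀ s ∈ Icc (0 : ℝ) 1, ∀ z, IsTrajectory X b s z → z s = q s → ∀ t ∈ Icc s 1,
      t - s < h₀ → ‖z t - q t‖ ≤ (D + ε) * (t - s) := by
  obtain ⟨δ, hδ, L, hL, hlip⟩ := exists_lipschitz_along h.convex h.diff h.continuousOn_fderiv
    le_rfl hq.continuousOn hq.mem
  refine ⟨min δ (ε / (2 * L)) / (D + ε), by positivity, fun s hs z hz hzq t ht hts => ?_⟩
  rw [lt_div_iff₀ (by positivity)] at hts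
  have hqs := hq.mono hs.1
  have hder : ∀ u ∈ Icc s 1, HasDerivWithinAt (fun u => z u - q u)
      (b u (z u) - (b u (q u) + d u (q u))) (Icc s 1) u := fun u hu =>
    (hz.deriv u hu).sub (hqs.deriv u hu)
  refine image_norm_le_of_norm_deriv_right_lt_deriv_boundary (a := s) (b := t)
    (B := fun u => (D + ε) * (u - s)) (B' := fun _ => D + ε)
    (fun u hu => ((hder u ⟨hu.1, hu.2.trans ht.2⟩).continuousWithinAt).mono
      (Icc_subset_Icc_right ht.2))
    (fun u hu => (hder u ⟨hu.1, hu.2.le.trans ht.2⟩).Ici_of_Icc ⟨hu.1, hu.2.trans_le ht.2⟩)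
    (by simp [hzq]) (fun u => by simpa using ((hasDerivAt_id u).sub_const s).const_mul (D + ε))
    ?_ (right_mem_Icc.2 ht.1)
  intro u hu hnorm
  have hu1 : u ∈ Icc s 1 := ⟨hu.1, hu.2.le.trans ht.2⟩
  have hu0 : u ∈ Icc (0 : ℝ) 1 := ⟨hs.1.trans hu1.1, hu1.2⟩
  have hsmall : ‖z u - q u‖ < min δ (ε / (2 * L)) := by
    rw [hnorm]
    refine lt_of_le_of_lt ?_ hts
    rw [mul_comm]
    have := hu.2.le
    gcongr
  have h1 := hlip u hu0 (z u) (hz.mem u hu1) (hsmall.trans_le (min_le_left _ _))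
  have h2 : L * ‖z u - q u‖ ≤ ε / 2 :=
    calc L * ‖z u - q u‖ ≤ L * (ε / (2 * L)) := by
          gcongr
          exact (hsmall.trans_le (min_le_right _ _)).le
      _ = ε / 2 := by field_simp
  calc ‖b u (z u) - (b u (q u) + d u (q u))‖ = ‖(b u (z u) - b u (q u)) - d u (q u)‖ := by
        rw [sub_sub]
    _ ≤ ‖b u (z u) - b u (q u)‖ + ‖d u (q u)‖ := norm_sub_le _ _
    _ ≤ ε / 2 + D := add_le_add (h1.trans h2) (hD _ (hq.mem u hu0) u hu0)
    _ < D + ε := by linarith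

open Filter Topology in
/-- Variation of constants without differentiating the flow: `s ↦ Φhat s τ (Φ 0 s y)` joins
`Φhat 0 τ y` to `Φ 0 τ y`, and by the Lipschitz bound for `Φhat` its speed at `s` is at most
`κ e^{a (τ - s)} D`. -/
theorem IsContracting.norm_perturbed_sub_le (h : IsContracting X b Θ m M' a) {Φhat : ℝ → ℝ → X → X}
    (hΦhat : IsTwoTimeFlow X b Φhat)
    {d : ℝ → EuclideanSpace ℝ (Fin n) → EuclideanSpace ℝ (Fin n)} {D : ℝ} (hD0 : 0 ≤ D)
    (hD : ∀ x ∈ X, ∀ τ ∈ Icc (0 : ℝ) 1, ‖d τ x‖ ≤ D)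
    (hΦ : IsTwoTimeFlow X (fun τ x => b τ x + d τ x) Φ) {τ : ℝ} (hτ : τ ∈ Icc (0 : ℝ) 1) (y : X) :
    ‖(Φ 0 τ y : EuclideanSpace ℝ (Fin n)) - Φhat 0 τ y‖ ≤ bias (kappa m M') D a τ := by
  have h00 : (0 : ℝ) ∈ Icc (0 : ℝ) 1 := ⟨le_rfl, zero_le_one⟩
  have hq := hΦ.isTrajectory h00 y
  have hκ := kappa_nonneg m M'
  set g : ℝ → EuclideanSpace ℝ (Fin n) := fun s => Φhat s τ (Φ 0 s y) with hg
  have hinc : ∀ ε > 0, ∃ h₀ > 0, ∀ s, 0 ≤ s → ∀ t ∈ Icc s τ, t - s < h₀ →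
      ‖g t - g s‖ ≤ kappa m M' * Real.exp (a * (τ - t)) * ((D + ε) * (t - s)) := by
    intro ε hε
    obtain ⟨h₀, hh₀, hcons⟩ := h.exists_consistency hD0 hD hq hε
    refine ⟨h₀, hh₀, fun s hs t ht hts => ?_⟩
    have hsI : s ∈ Icc (0 : ℝ) 1 := ⟨hs, (ht.1.trans ht.2).trans hτ.2⟩
    have htI : t ∈ Icc s 1 := ⟨ht.1, ht.2.trans hτ.2⟩
    have h1 := hcons s hsI _ (hΦhat.isTrajectory hsI (Φ 0 s y))
      (congrArg Subtype.val (hΦhat.self s hsI _)) t htI hts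
    have h2 := h.flow_norm_sub_le hΦhat ⟨hs.trans ht.1, htI.2⟩ ⟨ht.2, hτ.2⟩
      (Φhat s t (Φ 0 s y)) (Φ 0 t y)
    rw [h.flow_comp hΦhat hsI htI ⟨ht.2, hτ.2⟩, norm_sub_rev (Φ 0 t y : EuclideanSpace ℝ (Fin n))]
      at h2
    exact h2.trans (mul_le_mul_of_nonneg_left h1 (mul_nonneg hκ (Real.exp_pos _).le))
  have hcont : ContinuousOn g (Icc 0 τ) := by
    obtain ⟨h₀, hh₀, hinc1⟩ := hinc 1 one_pos
    set K := kappa m M' * Real.exp |a| * (D + 1) with hKdef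
    have hK : ∀ s, 0 ≤ s → ∀ t ∈ Icc s τ, t - s < h₀ → ‖g t - g s‖ ≤ K * (t - s) := by
      intro s hs t ht hts
      refine (hinc1 s hs t ht hts).trans ?_
      have h1 : a * (τ - t) ≤ |a| := by
        have h2 : a * (τ - t) ≤ |a| * (τ - t) :=
          mul_le_mul_of_nonneg_right (le_abs_self a) (by linarith [ht.2])
        have h3 : |a| * (τ - t) ≤ |a| * 1 :=
          mul_le_mul_of_nonneg_left (by linarith [ht.1, hτ.2]) (abs_nonneg a)
        linarith
      have h4 : 0 ≤ t - s := by linarith [ht.1]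
      rw [← mul_assoc, hKdef]
      gcongr
    intro s hs
    refine tendsto_iff_norm_sub_tendsto_zero.2 (squeeze_zero' (Eventually.of_forall
      fun _ => norm_nonneg _) (g := fun z => K * |z - s|) ?_ ?_)
    · filter_upwards [self_mem_nhdsWithin, mem_nhdsWithin_of_mem_nhds (Metric.ball_mem_nhds s hh₀)]
        with z hz hzs
      rw [Metric.mem_ball, Real.dist_eq] at hzs
      rcases le_total s z with hle | hle
      · rw [abs_of_nonneg (sub_nonneg.2 hle)] at hzs ⊢
        exact hK s hs.1 z ⟨hle, hz.2⟩ hzs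
      · rw [abs_sub_comm, abs_of_nonneg (sub_nonneg.2 hle)] at hzs ⊢
        rw [norm_sub_rev]
        exact hK z hz.1 s ⟨hle, hs.2⟩ hzs
    · have : Tendsto (fun z => K * |z - s|) (𝓝 s) (𝓝 (K * |s - s|)) :=
        Continuous.tendsto (by fun_prop) s
      rw [sub_self, abs_zero, mul_zero] at this
      exact this.mono_left nhdsWithin_le_nhds
  have hB : ∀ u, HasDerivAt (fun u => kappa m M' * D * ∫ r in (0 : ℝ)..u, Real.exp (a * (τ - r)))
      (kappa m M' * D * Real.exp (a * (τ - u))) u := fun u =>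
    (Continuous.integral_hasStrictDerivAt (f := fun r => Real.exp (a * (τ - r))) (by fun_prop)
      0 u).hasDerivAt.const_mul _
  have hmain := norm_sub_le_of_eventually_norm_sub_le hτ.1 hcont hB ?_
  · have h1 : g τ = Φ 0 τ y := congrArg Subtype.val (hΦhat.self τ hτ _)
    have h2 : g 0 = Φhat 0 τ y := by rw [hg]; simp only [hΦ.self 0 h00]
    simpa [h1, h2, bias] using hmain
  · intro u hu r hr
    have hlim1 : Tendsto (fun ε : ℝ => kappa m M' * Real.exp (a * (τ - u)) * (D + ε)) (𝓝[>] 0)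
        (𝓝 (kappa m M' * Real.exp (a * (τ - u)) * (D + 0))) :=
      (Continuous.tendsto (by fun_prop) 0).mono_left nhdsWithin_le_nhds
    obtain ⟨ε, hεr, hε⟩ := ((hlim1.eventually (gt_mem_nhds
      (show _ < r by linarith))).and self_mem_nhdsWithin).exists
    have hε : 0 < ε := hε
    have hlim2 : Tendsto (fun t : ℝ => kappa m M' * Real.exp (a * (τ - t)) * (D + ε)) (𝓝[>] u)
        (𝓝 (kappa m M' * Real.exp (a * (τ - u)) * (D + ε))) :=
      (Continuous.tendsto (by fun_prop) u).mono_left nhdsWithin_le_nhds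
    obtain ⟨h₀, hh₀, hincε⟩ := hinc ε hε
    filter_upwards [hlim2.eventually (gt_mem_nhds hεr),
      Ioo_mem_nhdsGT (show u < min τ (u + h₀) from lt_min hu.2 (by linarith))] with z hzr hz
    have hz1 : z < τ := hz.2.trans_le (min_le_left _ _)
    have hz2 : z < u + h₀ := hz.2.trans_le (min_le_right _ _)
    refine (hincε u hu.1 z ⟨hz.1.le, hz1.le⟩ (by linarith)).trans ?_
    rw [← mul_assoc]
    exact mul_le_mul_of_nonneg_right hzr.le (by linarith [hz.1])

theorem IsContracting.norm_flow_sub_perturbed_le (h : IsContracting X b Θ m M' a)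
    {Φhat : ℝ → ℝ → X → X} (hΦhat : IsTwoTimeFlow X b Φhat)
    {d : ℝ → EuclideanSpace ℝ (Fin n) → EuclideanSpace ℝ (Fin n)} {D : ℝ} (hD0 : 0 ≤ D)
    (hD : ∀ x ∈ X, ∀ τ ∈ Icc (0 : ℝ) 1, ‖d τ x‖ ≤ D)
    (hΦ : IsTwoTimeFlow X (fun τ x => b τ x + d τ x) Φ) {τ : ℝ} (hτ : τ ∈ Icc (0 : ℝ) 1)
    (x y : X) :
    ‖(Φhat 0 τ x : EuclideanSpace ℝ (Fin n)) - Φ 0 τ y‖ ≤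
      kappa m M' * Real.exp (a * τ) * ‖(x : EuclideanSpace ℝ (Fin n)) - y‖ +
        bias (kappa m M') D a τ := by
  have h1 := h.flow_norm_sub_le hΦhat ⟨le_rfl, zero_le_one⟩ hτ y x
  have h2 := h.norm_perturbed_sub_le hΦhat hD0 hD hΦ hτ y
  rw [sub_zero] at h1
  rw [norm_sub_rev] at h2
  exact (norm_sub_le_norm_sub_add_norm_sub _ _ _).trans (add_le_add h1 h2)

end Flow

/-! ### Pushforwards in Wasserstein space -/

section Wasserstein

variable {n : ℕ} {X : Set (EuclideanSpace ℝ (Fin n))}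

theorem W2_self (μ : Measure X) : W2 μ μ = 0 := by
  have hm : Measurable fun x : X => (x, x) := by fun_prop
  have hπ : μ.map (fun x : X => (x, x)) ∈ couplings μ μ := by
    constructor
    · rw [Measure.map_map measurable_fst hm]; exact Measure.map_id
    · rw [Measure.map_map measurable_snd hm]; exact Measure.map_id
  have hc : ∫⁻ p, ENNReal.ofReal
      (‖(p.1 : EuclideanSpace ℝ (Fin n)) - (p.2 : EuclideanSpace ℝ (Fin n))‖ ^ 2)
        ∂(μ.map (fun x : X => (x, x))) = 0 := by
    rw [lintegral_map (by fun_prop) hm]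
    simp
  rw [W2, ENNReal.rpow_eq_zero_iff]
  exact Or.inl ⟨le_antisymm ((iInf₂_le _ hπ).trans_eq hc) zero_le, by norm_num⟩

/-- A pointwise bound `‖S x - T y‖ ≤ c ‖x - y‖ + β` transfers to `W2`: push every coupling forward
by `S × T` and apply Minkowski's inequality. -/
theorem W2_map_le {S T : X → X} (hS : Measurable S) (hT : Measurable T) {c β : ℝ} (hc : 0 ≤ c)
    (hβ : 0 ≤ β)
    (h : ∀ x y : X, ‖(S x : EuclideanSpace ℝ (Fin n)) - T y‖ ≤
      c * ‖(x : EuclideanSpace ℝ (Fin n)) - y‖ + β)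
    (μ ν : Measure X) [IsProbabilityMeasure μ] [IsProbabilityMeasure ν] :
    W2 (μ.map S) (ν.map T) ≤ ENNReal.ofReal c * W2 μ ν + ENNReal.ofReal β := by
  let cost : Measure (X × X) → ℝ≥0∞ := fun π => ∫⁻ p, ENNReal.ofReal
    (‖(p.1 : EuclideanSpace ℝ (Fin n)) - (p.2 : EuclideanSpace ℝ (Fin n))‖ ^ 2) ∂π
  have hW : ∀ μ ν : Measure X, W2 μ ν = ⨅ π : couplings μ ν, cost π ^ (1 / 2 : ℝ) := by
    intro μ ν
    rw [W2, iInf_subtype']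
    exact (ENNReal.orderIsoRpow (1 / 2) (by norm_num)).map_iInf _
  have hne : Nonempty (couplings μ ν) :=
    ⟨μ.prod ν, by simp [couplings, Measure.map_fst_prod, Measure.map_snd_prod]⟩
  rw [hW μ ν, ENNReal.mul_iInf' (fun h => absurd h ENNReal.ofReal_ne_top) (fun _ => hne),
    ENNReal.iInf_add]
  refine le_iInf fun ⟨π, hπ1, hπ2⟩ => ?_
  have hprob : π univ = 1 := by
    have h1 := congrArg (fun ρ : Measure X => ρ univ) hπ1
    simpa [Measure.map_apply measurable_fst MeasurableSet.univ] using h1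
  have hST : Measurable (Prod.map S T) := hS.prodMap hT
  have hπ' : π.map (Prod.map S T) ∈ couplings (μ.map S) (ν.map T) := by
    constructor
    · rw [Measure.map_map measurable_fst hST, show Prod.fst ∘ Prod.map S T = S ∘ Prod.fst from rfl,
        ← Measure.map_map hS measurable_fst,
        hπ1]
    · rw [Measure.map_map measurable_snd hST, show Prod.snd ∘ Prod.map S T = T ∘ Prod.snd from rfl,
        ← Measure.map_map hT measurable_snd,
        hπ2]
  let F : X × X → ℝ≥0∞ := fun p => ENNReal.ofReal c *
    ENNReal.ofReal ‖(p.1 : EuclideanSpace ℝ (Fin n)) - p.2‖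
  let B : X × X → ℝ≥0∞ := fun _ => ENNReal.ofReal β
  have hcost : cost (π.map (Prod.map S T)) ≤ ∫⁻ p, (F + B) p ^ (2 : ℝ) ∂π := by
    simp only [cost]
    rw [lintegral_map (by fun_prop) hST]
    refine lintegral_mono fun p => ?_
    simp only [F, B]
    rw [ENNReal.ofReal_pow (norm_nonneg _), Pi.add_apply, ← ENNReal.ofReal_mul hc,
      ← ENNReal.ofReal_add (by positivity) hβ, ENNReal.rpow_two]
    gcongr
    exact h p.1 p.2
  have hmeas : Measurable fun p : X × X =>
      ENNReal.ofReal ‖(p.1 : EuclideanSpace ℝ (Fin n)) - p.2‖ := by fun_prop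
  calc W2 (μ.map S) (ν.map T) ≤ cost (π.map (Prod.map S T)) ^ (1 / 2 : ℝ) := by
        rw [hW]
        exact iInf_le (fun π : couplings (μ.map S) (ν.map T) => cost π ^ (1 / 2 : ℝ)) ⟨_, hπ'⟩
    _ ≤ (∫⁻ p, (F + B) p ^ (2 : ℝ) ∂π) ^ (1 / 2 : ℝ) := ENNReal.rpow_le_rpow hcost (by norm_num)
    _ ≤ (∫⁻ p, F p ^ (2 : ℝ) ∂π) ^ (1 / 2 : ℝ) + (∫⁻ p, B p ^ (2 : ℝ) ∂π) ^ (1 / 2 : ℝ) :=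
        ENNReal.lintegral_Lp_add_le (hmeas.const_mul _).aemeasurable aemeasurable_const
        (by norm_num)
    _ = ENNReal.ofReal c * cost π ^ (1 / 2 : ℝ) + ENNReal.ofReal β := by
      simp only [F, B, ENNReal.mul_rpow_of_nonneg _ _ (zero_le_two (α := ℝ))]
      rw [lintegral_const_mul _ (hmeas.pow_const _), lintegral_const, hprob, mul_one,
        ENNReal.mul_rpow_of_nonneg _ _ (by norm_num), ← ENNReal.rpow_mul, ← ENNReal.rpow_mul]
      simp only [cost, ENNReal.ofReal_pow (norm_nonneg _), ENNReal.rpow_two]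
      norm_num

theorem IsP2.map {μ : Measure X} (hμ : IsP2 μ) {T : X → X} (hT : Measurable T) {A C : ℝ}
    (h : ∀ x : X, ‖(T x : EuclideanSpace ℝ (Fin n))‖ ≤
      A + C * ‖(x : EuclideanSpace ℝ (Fin n))‖) : IsP2 (μ.map T) := by
  have := hμ.1
  refine ⟨Measure.isProbabilityMeasure_map hT.aemeasurable, ?_⟩
  rw [lintegral_map (by fun_prop) hT]
  calc ∫⁻ x, ENNReal.ofReal (‖(T x : EuclideanSpace ℝ (Fin n))‖ ^ 2) ∂μ ≤
      ∫⁻ x : X, (ENNReal.ofReal (2 * A ^ 2) + ENNReal.ofReal (2 * C ^ 2) *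
        ENNReal.ofReal (‖(x : EuclideanSpace ℝ (Fin n))‖ ^ 2)) ∂μ := by
        refine lintegral_mono fun x => ?_
        rw [← ENNReal.ofReal_mul (by positivity), ← ENNReal.ofReal_add (by positivity)
          (by positivity)]
        refine ENNReal.ofReal_le_ofReal ?_
        have h1 := pow_le_pow_left₀ (norm_nonneg _) (h x) 2
        nlinarith [sq_nonneg (A - C * ‖(x : EuclideanSpace ℝ (Fin n))‖)]
    _ = ENNReal.ofReal (2 * A ^ 2) + ENNReal.ofReal (2 * C ^ 2) *
        ∫⁻ x, ENNReal.ofReal (‖(x : EuclideanSpace ℝ (Fin n))‖ ^ 2) ∂μ := by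
        rw [lintegral_add_left measurable_const, lintegral_const_mul _ (by fun_prop),
          lintegral_const, measure_univ, mul_one]
    _ < ∞ := ENNReal.add_lt_top.2 ⟨ENNReal.ofReal_lt_top,
        ENNReal.mul_lt_top ENNReal.ofReal_lt_top hμ.2⟩

theorem IsDensity.isP2 {ρ : X → ℝ} (hρ : IsDensity ρ) : IsP2 (densityMeasure ρ) := by
  have hmeas : AEMeasurable (fun x => ENNReal.ofReal (ρ x)) (lebesgue X) :=
    hρ.integrable.aemeasurable.ennreal_ofReal
  constructor
  · constructor
    rw [densityMeasure, withDensity_apply _ MeasurableSet.univ, Measure.restrict_univ,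
      ← ofReal_integral_eq_lintegral_ofReal hρ.integrable hρ.nonneg, hρ.integral_eq_one,
      ENNReal.ofReal_one]
  · rw [densityMeasure, lintegral_withDensity_eq_lintegral_mul₀ hmeas (by fun_prop)]
    refine lt_of_le_of_lt (lintegral_mono fun x => ?_) hρ.second_moment.lintegral_lt_top
    rw [Pi.mul_apply, mul_comm, ENNReal.ofReal_mul (sq_nonneg _)]

end Wasserstein

theorem bias_nonneg {κ D a τ : ℝ} (hκ : 0 ≤ κ) (hD : 0 ≤ D) (hτ : 0 ≤ τ) : 0 ≤ bias κ D a τ :=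
  mul_nonneg (mul_nonneg hκ hD)
    (intervalIntegral.integral_nonneg hτ fun _ _ => (Real.exp_pos _).le)

end FlowContraction

theorem theorem5 {n : ℕ}
    -- the state space
    (X : Set (EuclideanSpace ℝ (Fin n))) (hXconv : Convex ℝ X) (hXint : (interior X).Nonempty)
    -- the learned two-time flow map and its induced velocity field
    (Φhat : ℝ → ℝ → X → X)
    (bhat : ℝ → EuclideanSpace ℝ (Fin n) → EuclideanSpace ℝ (Fin n))
    (hΦhat : IsTwoTimeFlow X bhat Φhat)
    (hΦhatC1 : ∀ x : X,
      ContDiffOn ℝ 1 (fun τ => (Φhat 0 τ x : EuclideanSpace ℝ (Fin n))) (Icc 0 1))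
    (hbhat : ∀ τ ∈ Icc (0 : ℝ) 1, DifferentiableOn ℝ (bhat τ) X)
    (hDbhat : ContinuousOn
      (fun p : EuclideanSpace ℝ (Fin n) × ℝ => fderivWithin ℝ (bhat p.2) X p.1)
      (X ×ˢ Icc (0 : ℝ) 1))
    -- the learned metric, its bounds, and the contraction residual for the rate `α`
    (Θ : EuclideanSpace ℝ (Fin n) → ℝ → Matrix (Fin n) (Fin n) ℝ)
    (hM : ∀ i j, DifferentiableOn ℝ
      (fun p : EuclideanSpace ℝ (Fin n) × ℝ => metric Θ p.1 p.2 i j)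
      (X ×ˢ Icc (0 : ℝ) 1))
    (mlow mup : ℝ) (hmlow : 0 < mlow)
    (hMlow : ∀ x ∈ X, ∀ τ ∈ Icc (0 : ℝ) 1,
      (metric Θ x τ - mlow • (1 : Matrix (Fin n) (Fin n) ℝ)).PosSemidef)
    (hMup : ∀ x ∈ X, ∀ τ ∈ Icc (0 : ℝ) 1,
      (mup • (1 : Matrix (Fin n) (Fin n) ℝ) - metric Θ x τ).PosSemidef)
    (α : ℝ)
    (hRcont : ContinuousOn
      (fun p : EuclideanSpace ℝ (Fin n) × ℝ =>
        contractionResidual X bhat Θ α p.1 p.2)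
      (X ×ˢ Icc (0 : ℝ) 1))
    (hε : BddAbove (residualNorms X bhat Θ α))
    -- the exact velocity field, a perturbation of the learned one, and its two-time flow map
    (Φ : ℝ → ℝ → X → X)
    (b d : ℝ → EuclideanSpace ℝ (Fin n) → EuclideanSpace ℝ (Fin n))
    (hΦ : IsTwoTimeFlow X b Φ)
    (hΦmeas : ∀ τ ∈ Icc (0 : ℝ) 1, Measurable (Φ 0 τ))
    (hbd : ∀ τ ∈ Icc (0 : ℝ) 1, ∀ x ∈ X, b τ x = bhat τ x + d τ x)
    (hd : BddAbove (mismatchNorms X d)) :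
    -- contraction inequality for the learned field with the inflated rate
    (∀ x ∈ X, ∀ τ ∈ Icc (0 : ℝ) 1,
      ((2 * alphaTilde X bhat Θ α mlow) • metric Θ x τ -
        (metricDot X bhat Θ x τ +
          (2 : ℝ) • symPart
            (metric Θ x τ * jacobian X bhat x τ))).PosSemidef) ∧
    -- bound along the two flows
    (∀ μ₀ ν₀ : Measure X, IsP2 μ₀ → IsP2 ν₀ →
      ∀ τ ∈ Icc (0 : ℝ) 1,
        IsP2 (perronFrobenius (Φhat 0 τ) μ₀) ∧
        IsP2 (perronFrobenius (Φ 0 τ) ν₀) ∧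
        W2 (perronFrobenius (Φhat 0 τ) μ₀)
            (perronFrobenius (Φ 0 τ) ν₀) ≤
          ENNReal.ofReal (kappa mlow mup * Real.exp (alphaTilde X bhat Θ α mlow * τ)) * W2 μ₀ ν₀ +
            ENNReal.ofReal (bias (kappa mlow mup) (mismatch X d)
              (alphaTilde X bhat Θ α mlow) τ)) ∧
    -- bound for the terminal operators on densities
    (∀ ρ η : X → ℝ, IsDensity ρ → IsDensity η →
      W2 (perronFrobenius (Φhat 0 1) (densityMeasure ρ))
          (perronFrobenius (Φ 0 1) (densityMeasure η)) ≤
        ENNReal.ofReal (kappa mlow mup * Real.exp (alphaTilde X bhat Θ α mlow)) *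
            W2 (densityMeasure ρ)
              (densityMeasure η) +
          ENNReal.ofReal (bias (kappa mlow mup) (mismatch X d)
              (alphaTilde X bhat Θ α mlow) 1)) ∧
    -- terminal bias for the same input density
    (∀ ρ : X → ℝ, IsDensity ρ →
      W2 (perronFrobenius (Φhat 0 1) (densityMeasure ρ))
          (perronFrobenius (Φ 0 1) (densityMeasure ρ)) ≤
        ENNReal.ofReal (bias (kappa mlow mup) (mismatch X d)
              (alphaTilde X bhat Θ α mlow) 1)) := by
  have hC : IsContracting X bhat Θ mlow mup (alphaTilde X bhat Θ α mlow) :=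
    ⟨hXconv, hbhat, hDbhat, hM, hmlow, hMlow, hMup,
      fun x hx τ hτ => posSemidef_alphaTilde hmlow hMlow hε hx hτ⟩
  obtain ⟨x₀, hx₀⟩ := hXint.mono interior_subset
  have hD : ∀ x ∈ X, ∀ τ ∈ Icc (0 : ℝ) 1, ‖d τ x‖ ≤ mismatch X d := fun x hx τ hτ =>
    le_csSup hd ⟨(x, τ), ⟨hx, hτ⟩, rfl⟩
  have hD0 : 0 ≤ mismatch X d :=
    (norm_nonneg _).trans (hD x₀ hx₀ 0 ⟨le_rfl, zero_le_one⟩)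
  have hΦ' : IsTwoTimeFlow X (fun τ x => bhat τ x + d τ x) Φ :=
    ⟨hΦ.self, fun s hs t ht x => (hbd t ⟨hs.1.trans ht.1, ht.2⟩ _ (Φ s t x).2) ▸
      hΦ.deriv s hs t ht x⟩
  set a := alphaTilde X bhat Θ α mlow
  have hpoint := fun τ hτ => hC.norm_flow_sub_perturbed_le (τ := τ) hΦhat hD0 hD hΦ' hτ
  have hlip := fun τ hτ => hC.flow_norm_sub_le (t := τ) hΦhat ⟨le_rfl, zero_le_one⟩ hτ
  have hc : ∀ τ, 0 ≤ kappa mlow mup * Real.exp (a * τ) := fun τ =>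
    mul_nonneg (kappa_nonneg _ _) (Real.exp_pos _).le
  have hβ : ∀ τ ∈ Icc (0 : ℝ) 1, 0 ≤ bias (kappa mlow mup) (mismatch X d) a τ := fun τ hτ =>
    bias_nonneg (kappa_nonneg _ _) hD0 hτ.1
  -- the learned flow is Lipschitz, hence Borel
  have hmeas : ∀ τ ∈ Icc (0 : ℝ) 1, Measurable (Φhat 0 τ) := fun τ hτ => by
    refine (LipschitzWith.of_dist_le_mul
      (K := ⟨kappa mlow mup * Real.exp (a * (τ - 0)), by simpa using hc τ⟩)
      fun x y => ?_).continuous.measurable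
    rw [Subtype.dist_eq, Subtype.dist_eq, dist_eq_norm, dist_eq_norm]
    exact hlip τ hτ y x
  have main : ∀ μ₀ ν₀ : Measure X, IsP2 μ₀ → IsP2 ν₀ → ∀ τ ∈ Icc (0 : ℝ) 1,
      IsP2 (perronFrobenius (Φhat 0 τ) μ₀) ∧ IsP2 (perronFrobenius (Φ 0 τ) ν₀) ∧
        W2 (perronFrobenius (Φhat 0 τ) μ₀) (perronFrobenius (Φ 0 τ) ν₀) ≤
          ENNReal.ofReal (kappa mlow mup * Real.exp (a * τ)) * W2 μ₀ ν₀ +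
            ENNReal.ofReal (bias (kappa mlow mup) (mismatch X d) a τ) := by
    intro μ₀ ν₀ hμ hν τ hτ
    have := hμ.1
    have := hν.1
    set c := kappa mlow mup * Real.exp (a * τ)
    set β := bias (kappa mlow mup) (mismatch X d) a τ
    have hxx : ∀ x : X, ‖(x : EuclideanSpace ℝ (Fin n)) - x₀‖ ≤
        ‖(x : EuclideanSpace ℝ (Fin n))‖ + ‖x₀‖ := fun x => norm_sub_le _ _
    refine ⟨hμ.map (hmeas τ hτ) (A := c * ‖x₀‖ + ‖(Φhat 0 τ ⟨x₀, hx₀⟩ : EuclideanSpace ℝ (Fin n))‖)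
        (C := c) fun x => ?_,
      hν.map (hΦmeas τ hτ)
        (A := c * ‖x₀‖ + β + ‖(Φhat 0 τ ⟨x₀, hx₀⟩ : EuclideanSpace ℝ (Fin n))‖) (C := c)
        fun y => ?_,
      W2_map_le (hmeas τ hτ) (hΦmeas τ hτ) (hc τ) (hβ τ hτ) (hpoint τ hτ) μ₀ ν₀⟩
    · have h1 := hlip τ hτ ⟨x₀, hx₀⟩ x
      rw [sub_zero] at h1
      have h2 := norm_le_norm_add_norm_sub' (Φhat 0 τ x : EuclideanSpace ℝ (Fin n))
        (Φhat 0 τ ⟨x₀, hx₀⟩)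
      have h3 := mul_le_mul_of_nonneg_left (hxx x) (hc τ)
      linarith
    · have h1 := hpoint τ hτ ⟨x₀, hx₀⟩ y
      rw [norm_sub_rev, norm_sub_rev x₀] at h1
      have h2 := norm_le_norm_add_norm_sub' (Φ 0 τ y : EuclideanSpace ℝ (Fin n))
        (Φhat 0 τ ⟨x₀, hx₀⟩)
      have h3 := mul_le_mul_of_nonneg_left (hxx y) (hc τ)
      linarith
  have terminal : ∀ ρ η : X → ℝ, IsDensity ρ → IsDensity η →
      W2 (perronFrobenius (Φhat 0 1) (densityMeasure ρ))
          (perronFrobenius (Φ 0 1) (densityMeasure η)) ≤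
        ENNReal.ofReal (kappa mlow mup * Real.exp a) * W2 (densityMeasure ρ) (densityMeasure η) +
          ENNReal.ofReal (bias (kappa mlow mup) (mismatch X d) a 1) := by
    intro ρ η hρ hη
    simpa only [mul_one] using
      (main _ _ hρ.isP2 hη.isP2 1 ⟨zero_le_one, le_rfl⟩).2.2
  refine ⟨hC.contracts, main, terminal, fun ρ hρ => ?_⟩
  simpa only [W2_self, mul_zero, zero_add] using terminal ρ ρ hρ hρ
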